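/- **The finite system.** Let $\lambda,\beta>0$ and let $L_n>0$ $(n\ge 1)$ satisfy $n/L_n\to\lambda$ as $n\to\infty$. On a probability space, for every $n\ge1$, let $n-1$ independent random points, uniformly distributed on $\Lambda_n=[-L_n/2,L_n/2]$, be given (no assumption is made on the joint law for different $n$). Ordered increasingly and together with $x_0=-L_n/2$, $x_n=L_n/2$ they cut $\Lambda_n$ into $n$ intervals $I_j=(x_{j-1},x_j)$ of lengths $\ell_j=\ell_j^{\omega}$, $j=1,\dots,n$. On each interval consider the Dirichlet eigenvalues and normalized eigenfunctions of $-\frac12\frac{d^2}{dx^2}$, for $s=1,2,\dots$: $$E_s(\ell_j)=\frac{\pi^2s^2}{2\ell_j^2},\qquad \psi_{j,s}(x)=\mathbb 1_{I_j}(x)\sqrt{\tfrac{2}{\ell_j}}\,\sin\Big(\tfrac{\pi s}{\ell_j}(x-x_{j-1})\Big).$$ For $\mu<\min_jE_1(\ell_j)$ define the particle density, the one-body reduced density matrix and its space average by $$\rho_n^\omega(\beta,\mu)=\frac1{L_n}\sum_{j=1}^n\sum_{s\ge1}\frac1{e^{\beta(E_s(\ell_j)-\mu)}-1},\qquad \rho_n^\omega(x,y;\beta,\mu)=\sum_{j=1}^n\sum_{s\ge1}\frac{\psi_{j,s}(x)\,\psi_{j,s}(y)}{e^{\beta(E_s(\ell_j)-\mu)}-1},$$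 $$\tilde\rho_n^\omega(x,y;\beta,\mu)=\frac1{L_n}\int_{-L_n/2}^{L_n/2}\rho_n^\omega(x+z,y+z;\beta,\mu)\,dz .$$ **The critical density.** With $c=\pi/\sqrt2$ and $$n_\lambda(E)=\frac{\lambda^2c}{2}\,\frac{e^{c\lambda/\sqrt E}}{E^{3/2}(e^{c\lambda/\sqrt E}-1)^2},$$ set $\rho_c(\beta)=\lim_{\mu\uparrow0}\int_0^\infty\frac{n_\lambda(E)}{e^{\beta(E-\mu)}-1}\,dE$. **Claim.** The limit defining $\rho_c(\beta)$ exists and is finite. Let $\rho>\rho_c(\beta)$. Then: 1. Almost surely, for every $n\ge1$ the equation $\rho_n^\omega(\beta,\mu)=\rho$ has exactly one solution $\mu=\mu_n^\omega(\beta,\rho)<\min_jE_1(\ell_j)$, and almost surely $\mu_n^\omega(\beta,\rho)\to0$ as $n\to\infty$. 2. The condensate density $$\rho_0(\beta,\rho)=\lim_{\epsilon\downarrow0}\ \text{a.s.}\lim_{n\to\infty}\frac1{L_n}\sum_{(j,s):\,E_s(\ell_j)\le\epsilon}\frac1{e^{\beta(E_s(\ell_j)-\mu_n^\omega(\beta,\rho))}-1}$$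 exists (for every $\epsilon>0$ the inner almost sure limit exists and is nonrandom), and $\rho_0(\beta,\rho)=\rho-\rho_c(\beta)>0$. 3. For all $x,y\in\mathbb R$ the space-averaged reduced density matrix $\tilde\rho_n^\omega(x,y;\beta,\mu_n^\omega(\beta,\rho))$ converges almost surely, as $n\to\infty$, to a nonrandom limit $\tilde\rho(x,y)$. 4. There is off-diagonal long-range order, equal to the condensate density: $$\lim_{|x-y|\to\infty}\tilde\rho(x,y)=\rho_0(\beta,\rho).$$ -/

import Mathlib

open Real Set Filter Topology MeasureTheory ProbabilityTheory

noncomputable section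

namespace LuttingerSy

/-! ### The Dirichlet Laplacian `-½ d²/dx²` on an interval -/

/-- `f` is an eigenfunction, with eigenvalue `E`, of `-½ d²/dx²` on `[a, b]` with Dirichlet
boundary conditions. -/
def IsDirichletEigenfunction (a b E : ℝ) (f : ℝ → ℝ) : Prop :=
  (∃ f' f'' : ℝ → ℝ,
    (∀ x ∈ Icc a b, HasDerivWithinAt f (f' x) (Icc a b) x) ∧
    (∀ x ∈ Icc a b, HasDerivWithinAt f' (f'' x) (Icc a b) x) ∧
    (∀ x ∈ Icc a b, -(1 / 2) * f'' x = E * f x)) ∧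
  f a = 0 ∧ f b = 0 ∧ ∃ x ∈ Icc a b, f x ≠ 0

/-- The `s`-th Dirichlet eigenvalue, `s = 1, 2, …`, of `-½ d²/dx²` on an interval of
length `ℓ`. -/
def energy (ℓ : ℝ) (s : ℕ) : ℝ := (1 / 2) * (π ^ 2 * (s : ℝ) ^ 2 / ℓ ^ 2)

/-- The `s`-th normalized Dirichlet eigenfunction on `(a, b)`, extended by zero. -/
def eigenfun (a b : ℝ) (s : ℕ) (x : ℝ) : ℝ :=
  (Ioo a b).indicator (fun x => √(2 / (b - a)) * Real.sin (π * s / (b - a) * (x - a))) x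

/-! ### The finite system: `N` impurities in `[-L/2, L/2]`, hence `N + 1` intervals -/

/-- The points `-L/2 = x₀ ≤ x₁ ≤ … ≤ x_N ≤ x_{N+1} = L/2`, where `x₁, …, x_N` are the impurity
positions `x` in increasing order. -/
def node {N : ℕ} (L : ℝ) (x : Fin N → ℝ) : Fin (N + 2) → ℝ :=
  Fin.cons (α := fun _ => ℝ) (-L / 2)
    (Fin.snoc (α := fun _ => ℝ) (x ∘ Tuple.sort x) (L / 2))

/-- Left end-point of the `j`-th interval. -/
def left {N : ℕ} (L : ℝ) (x : Fin N → ℝ) (j : Fin (N + 1)) : ℝ := node L x j.castSucc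

/-- Right end-point of the `j`-th interval. -/
def right {N : ℕ} (L : ℝ) (x : Fin N → ℝ) (j : Fin (N + 1)) : ℝ := node L x j.succ

/-- Length of the `j`-th interval. -/
def gap {N : ℕ} (L : ℝ) (x : Fin N → ℝ) (j : Fin (N + 1)) : ℝ := right L x j - left L x j

/-- Bose–Einstein occupation number of a level of energy `E`. -/
def occ (β μ E : ℝ) : ℝ := 1 / (Real.exp (β * (E - μ)) - 1)

/-- Grand-canonical particle density of the finite system. -/
def density {N : ℕ} (L : ℝ) (x : Fin N → ℝ) (β μ : ℝ) : ℝ :=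
  (1 / L) * ∑ j : Fin (N + 1), ∑' s : ℕ, occ β μ (energy (gap L x j) (s + 1))

/-- Density of the particles in the levels of energy at most `ε`, i.e. the integral over
`(0, ε]` of the occupation number against the finite-volume density-of-states measure. -/
def lowDensity {N : ℕ} (L : ℝ) (x : Fin N → ℝ) (β μ ε : ℝ) : ℝ :=
  (1 / L) * ∑ j : Fin (N + 1), ∑' s : ℕ,
    (Iic ε).indicator (occ β μ) (energy (gap L x j) (s + 1))

/-- `μ` lies below the spectrum and solves `ρ = ρ_L(β, μ)`. -/
def IsChemPot {N : ℕ} (L : ℝ) (x : Fin N → ℝ) (β ρ μ : ℝ) : Prop :=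
  (∀ (j : Fin (N + 1)) (s : ℕ), μ < energy (gap L x j) (s + 1)) ∧ density L x β μ = ρ

open Classical in
/-- The finite-volume chemical potential at density `ρ`: the solution of `IsChemPot`
(and `0` if there is none). -/
def chemPot {N : ℕ} (L : ℝ) (x : Fin N → ℝ) (β ρ : ℝ) : ℝ :=
  if h : ∃ μ, IsChemPot L x β ρ μ then h.choose else 0

/-- Kernel of the one-body reduced density matrix of the finite system. -/
def densityMatrix {N : ℕ} (L : ℝ) (x : Fin N → ℝ) (β μ : ℝ) (u v : ℝ) : ℝ :=
  ∑ j : Fin (N + 1), ∑' s : ℕ, occ β μ (energy (gap L x j) (s + 1)) *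
    (eigenfun (left L x j) (right L x j) (s + 1) u *
      eigenfun (left L x j) (right L x j) (s + 1) v)

/-- The space-averaged reduced density matrix of the finite system. -/
def avgDensityMatrix {N : ℕ} (L : ℝ) (x : Fin N → ℝ) (β μ : ℝ) (u v : ℝ) : ℝ :=
  (1 / L) * ∫ z in (-L / 2)..(L / 2), densityMatrix L x β μ (u + z) (v + z)

/-! ### Infinite-volume quantities -/

/-- Limiting density of states, with `c = π / √2`. -/
def dos (lam E : ℝ) : ℝ :=
  lam ^ 2 * (π / √2) / 2 *
    (Real.exp (π / √2 * lam / √E) /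
      (E ^ (3 / 2 : ℝ) * (Real.exp (π / √2 * lam / √E) - 1) ^ 2))

/-- Limiting grand-canonical density for `μ < 0`. -/
def limDensity (lam β μ : ℝ) : ℝ := ∫ E in Ioi (0 : ℝ), dos lam E * occ β μ E

/-- Critical density: the limit of `limDensity` as `μ ↑ 0`. -/
def critDensity (lam β : ℝ) : ℝ := limUnder (𝓝[<] (0 : ℝ)) (limDensity lam β)

/-! ### `energy` and `eigenfun` are the Dirichlet eigenvalues and eigenfunctions -/

/-- On a nondegenerate interval, the Dirichlet eigenfunctions of `-½ d²/dx²` are exactly the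
nonzero multiples of the functions `eigenfun a b s`, `s ≥ 1`, with eigenvalues
`energy (b - a) s`. -/
theorem isDirichletEigenfunction_iff {a b : ℝ} (hab : a < b) (E : ℝ) (f : ℝ → ℝ) :
    IsDirichletEigenfunction a b E f ↔
      ∃ s : ℕ, 1 ≤ s ∧ E = energy (b - a) s ∧
        ∃ C : ℝ, C ≠ 0 ∧ ∀ x ∈ Icc a b, f x = C * eigenfun a b s x := by
  have hℓ : 0 < b - a := sub_pos.2 hab
  have haI : a ∈ Icc a b := ⟨le_rfl, hab.le⟩
  have hbI : b ∈ Icc a b := ⟨hab.le, le_rfl⟩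
  -- on the closed interval the indicator is invisible
  have heig : ∀ (s : ℕ), ∀ x ∈ Icc a b,
      eigenfun a b s x = √(2 / (b - a)) * Real.sin (π * s / (b - a) * (x - a)) := by
    intro s x hx
    unfold eigenfun
    by_cases h : x ∈ Ioo a b
    · rw [indicator_of_mem h]
    · rw [indicator_of_notMem h]
      have : x = a ∨ x = b := by
        rcases eq_or_lt_of_le hx.1 with h1 | h1
        · exact Or.inl h1.symm
        · rcases eq_or_lt_of_le hx.2 with h2 | h2
          · exact Or.inr h2
          · exact absurd ⟨h1, h2⟩ h
      rcases this with rfl | rfl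
      · simp
      · have : π * s / (x - a) * (x - a) = s * π := by field_simp
        rw [this, Real.sin_nat_mul_pi, mul_zero]
  have hsq : 0 < √(2 / (b - a)) := Real.sqrt_pos.2 (by positivity)
  constructor
  · rintro ⟨⟨f', f'', h1, h2, h3⟩, hfa, hfb, x₀, hx₀, hfx₀⟩
    have h2' : ∀ x ∈ Icc a b, HasDerivWithinAt f' (-(2 * E) * f x) (Icc a b) x := by
      intro x hx
      have : f'' x = -(2 * E) * f x := by linarith [h3 x hx]
      exact this ▸ h2 x hx
    have const : ∀ g : ℝ → ℝ, (∀ x ∈ Icc a b, HasDerivWithinAt g 0 (Icc a b) x) →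
        ∀ x ∈ Icc a b, g x = g a := by
      intro g hg x hx
      refine constant_of_has_deriv_right_zero (fun y hy => (hg y hy).continuousWithinAt)
        (fun y hy => ?_) x hx
      exact (hg y ⟨hy.1, hy.2.le⟩).mono_of_mem_nhdsWithin
        (Icc_mem_nhdsGE_of_mem hy)
    have hEpos : 0 < E := by
      by_contra hE
      push Not at hE
      have hmono : MonotoneOn (fun x => f x * f' x) (Icc a b) := by
        refine monotoneOn_of_hasDerivWithinAt_nonneg (convex_Icc a b)
          (f' := fun x => f' x * f' x + f x * (-(2 * E) * f x)) (fun y hy =>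
            ((h1 y hy).mul (h2' y hy)).continuousWithinAt) (fun y hy => ?_) (fun y hy => ?_)
        · have hy' := interior_subset hy
          exact ((h1 y hy').mul (h2' y hy')).mono interior_subset
        · nlinarith [mul_self_nonneg (f' y), mul_self_nonneg (f y),
            mul_nonneg (neg_nonneg.2 hE) (mul_self_nonneg (f y))]
      have hzero : ∀ x ∈ Icc a b, f x * f' x = 0 := by
        intro x hx
        have l := hmono haI hx hx.1
        have r := hmono hx hbI hx.2
        simp only [hfa, hfb, zero_mul] at l r
        exact le_antisymm r l
      have hsqc := const (fun x => f x * f x) (fun x hx => by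
        have := (h1 x hx).mul (h1 x hx)
        have e : f' x * f x + f x * f' x = 0 := by linarith [hzero x hx, mul_comm (f x) (f' x)]
        exact e ▸ this) x₀ hx₀
      simp only [hfa, mul_zero] at hsqc
      exact hfx₀ (mul_self_eq_zero.1 hsqc)
    set k : ℝ := √(2 * E) with hk
    have hkpos : 0 < k := Real.sqrt_pos.2 (by positivity)
    have hk2 : k * k = 2 * E := Real.mul_self_sqrt (by positivity)
    have hsin : ∀ x, HasDerivWithinAt (fun x => Real.sin (k * (x - a)))
        (Real.cos (k * (x - a)) * k) (Icc a b) x := by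
      intro x
      have : HasDerivAt (fun x => k * (x - a)) k x := by
        simpa using ((hasDerivAt_id x).sub_const a).const_mul k
      exact this.sin.hasDerivWithinAt
    have hcos : ∀ x, HasDerivWithinAt (fun x => Real.cos (k * (x - a)))
        (-Real.sin (k * (x - a)) * k) (Icc a b) x := by
      intro x
      have : HasDerivAt (fun x => k * (x - a)) k x := by
        simpa using ((hasDerivAt_id x).sub_const a).const_mul k
      exact this.cos.hasDerivWithinAt
    have hP := const
      (fun x => f' x * Real.sin (k * (x - a)) - k * (f x * Real.cos (k * (x - a)))) (by
        intro x hx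
        have := ((h2' x hx).mul (hsin x)).sub (((h1 x hx).mul (hcos x)).const_mul k)
        refine this.congr_deriv ?_
        linear_combination ((f x) * Real.sin (k * (x - a))) * hk2)
    have hQ := const
      (fun x => f' x * Real.cos (k * (x - a)) + k * (f x * Real.sin (k * (x - a)))) (by
        intro x hx
        have := ((h2' x hx).mul (hcos x)).add (((h1 x hx).mul (hsin x)).const_mul k)
        refine this.congr_deriv ?_
        linear_combination ((f x) * Real.cos (k * (x - a))) * hk2)
    have hform : ∀ x ∈ Icc a b, k * f x = f' a * Real.sin (k * (x - a)) := by
      intro x hx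
      have p := hP x hx
      have q := hQ x hx
      simp only [sub_self, mul_zero, Real.sin_zero, Real.cos_zero, hfa, mul_one,
        add_zero] at p q
      linear_combination (Real.sin (k * (x - a))) * q - (Real.cos (k * (x - a))) * p
        - k * f x * (Real.sin_sq_add_cos_sq (k * (x - a)))
    have hA : f' a ≠ 0 := by
      intro h
      have := hform x₀ hx₀
      rw [h, zero_mul] at this
      exact hfx₀ ((mul_eq_zero.1 this).resolve_left hkpos.ne')
    have hs0 : Real.sin (k * (b - a)) = 0 := by
      have := hform b hbI
      rw [hfb, mul_zero] at this
      exact (mul_eq_zero.1 this.symm).resolve_left hA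
    obtain ⟨m, hm⟩ := Real.sin_eq_zero_iff.1 hs0
    have hmpos : 0 < m := by
      have : (0 : ℝ) < m * π := hm ▸ mul_pos hkpos hℓ
      exact_mod_cast (pos_of_mul_pos_left this Real.pi_pos.le)
    obtain ⟨s, rfl⟩ := Int.eq_ofNat_of_zero_le hmpos.le
    have hkval : k = π * s / (b - a) := by
      rw [eq_div_iff hℓ.ne', ← hm]; push_cast; ring
    refine ⟨s, by exact_mod_cast hmpos, ?_, f' a / (k * √(2 / (b - a))), by positivity, ?_⟩
    · have : E = (1 / 2) * (k * k) := by rw [hk2]; ring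
      rw [this, hkval, energy]
      field_simp
    · intro x hx
      rw [heig s x hx, ← hkval]
      have := hform x hx
      field_simp
      linarith
  · rintro ⟨s, hs, rfl, C, hC, hf⟩
    set k : ℝ := π * s / (b - a) with hk
    set D : ℝ := C * √(2 / (b - a)) with hD
    have hf' : ∀ x ∈ Icc a b, f x = D * Real.sin (k * (x - a)) := by
      intro x hx; rw [hf x hx, heig s x hx]; ring
    have hlin : ∀ x, HasDerivAt (fun x => k * (x - a)) k x := by
      intro x
      simpa using ((hasDerivAt_id x).sub_const a).const_mul k
    have hs' : (0 : ℝ) < s := by exact_mod_cast hs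
    refine ⟨⟨fun x => D * (Real.cos (k * (x - a)) * k),
      fun x => D * (-Real.sin (k * (x - a)) * k * k), ?_, ?_, ?_⟩, ?_, ?_, ?_⟩
    · intro x hx
      exact (((hlin x).sin.const_mul D).hasDerivWithinAt).congr hf' (hf' x hx)
    · intro x _
      exact (((hlin x).cos.mul_const k).const_mul D).hasDerivWithinAt
    · intro x hx
      rw [hf' x hx, energy, hk]
      field_simp
    · rw [hf' a haI]; simp
    · rw [hf' b hbI]
      have : k * (b - a) = s * π := by rw [hk]; field_simp
      rw [this, Real.sin_nat_mul_pi, mul_zero]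
    · refine ⟨a + (b - a) / (2 * s), ⟨by linarith [show 0 < (b - a) / (2 * s) by positivity], ?_⟩, ?_⟩
      · have : (b - a) / (2 * s) ≤ b - a := by
          apply div_le_self hℓ.le
          have : (1 : ℝ) ≤ s := by exact_mod_cast hs
          linarith
        linarith
      · have hmem : a + (b - a) / (2 * s) ∈ Icc a b := by
          refine ⟨by linarith [show 0 < (b - a) / (2 * s) by positivity], ?_⟩
          have : (b - a) / (2 * s) ≤ b - a := by
            apply div_le_self hℓ.le
            have : (1 : ℝ) ≤ s := by exact_mod_cast hs
            linarith
          linarith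
        rw [hf' _ hmem]
        have : k * (a + (b - a) / (2 * s) - a) = π / 2 := by rw [hk]; field_simp; ring
        rw [this, Real.sin_pi_div_two, mul_one]
        exact mul_ne_zero hC hsq.ne'

end LuttingerSy

end

noncomputable section

namespace LuttingerSy

/-! ### Energy levels and occupation numbers -/

/-! Everything is read off from one law of large numbers for the gaps: if `F` is measurable, almost
everywhere continuous on `(0, ∞)` and `|F ℓ| ≤ C ℓ`, then `L⁻¹ ∑ F(ℓ_j)` tends to `λ² ∫ e^{-λℓ} F(ℓ)
dℓ` (`tendsto_sum_gaps`). For `F(ℓ) = max (ℓ - t) 0` the sum is the length of the set of `z` whose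
window `(z, z + t)` is empty (`volume_emptyWindows`). Its mean is explicit and moving one impurity
changes it by at most `t`, so bounded differences and Borel–Cantelli give almost sure convergence
for all rational `t`, with no assumption on the joint law for different `N`
(`ae_tendsto_emptyWindows`). These functions determine the size-biased law of the gaps, whose weak
convergence to `λ² ℓ e^{-λℓ} dℓ` (`tendsto_sizeBiased`) yields general `F`. From there on the
argument is deterministic, for a fixed `IsTypical` sequence.

Sums over the levels above a cutoff `ε > μ` grow at most linearly in `ℓ`, so the law of large
numbers applies to them. At `μ = 0` without cutoff only a bound `C ℓ²` is available
(`abs_cutoffSum_le_sq`): the limiting integral is finite, and the substitution `E = E_s(ℓ)`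
identifies it with `ρ_c` (`limDensity_eq_limCutoff`, `critDensity_eq`), but the law of large numbers
no longer covers it. This leaves room for the condensate. For `δ < 0` the density at `δ` has a limit
at most `ρ_c < ρ`, which forces `μ_n > δ` eventually; arbitrarily long gaps push the ground energy,
an upper bound for `μ_n`, to `0`. Once `μ_n → 0`, the levels above `ε > 0` carry `limCutoff` at `(ε,
0)`, the remainder of `ρ` lies below `ε`, and `ε ↓ 0` leaves `ρ - ρ_c`.

For the density matrix, the integral of `ψ(x + z) ψ(y + z)` over all `z` is the explicit `overlap`,
and restricting `z` to the box loses intervals of total length at most `|x|`. A level of energy at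
most `ε` lives on an interval of length at least `ε^{-1/2}`, so its overlap is `1 - O(√ε)` and the
low levels contribute almost their full density, for any fixed `x - y`. The high levels obey the law
of large numbers with weight `overlap`. Letting `ε ↓ 0` after `N → ∞` gives `ρ₀` plus a `limCutoff`
with weight `overlap |x - y|`; the latter tends to `0` by dominated convergence, since the overlap
vanishes once `|x - y| > ℓ`. -/

lemma energy_pos {ℓ : ℝ} (hℓ : 0 < ℓ) (s : ℕ) : 0 < energy ℓ (s + 1) := by
  unfold energy; push_cast; positivity

lemma energy_anti {ℓ m : ℝ} (hℓ : 0 < ℓ) (h : ℓ ≤ m) (s : ℕ) : energy m s ≤ energy ℓ s := by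
  unfold energy; gcongr

lemma energy_one_le (ℓ : ℝ) (s : ℕ) : energy ℓ 1 ≤ energy ℓ (s + 1) := by
  unfold energy
  have : (1 : ℝ) ≤ (s + 1 : ℕ) := by exact_mod_cast Nat.le_add_left 1 s
  gcongr
  exact_mod_cast this

lemma measurable_energy (s : ℕ) : Measurable (fun ℓ => energy ℓ s) := by
  unfold energy; fun_prop

lemma continuousAt_energy {ℓ : ℝ} (hℓ : ℓ ≠ 0) (s : ℕ) :
    ContinuousAt (fun ℓ => energy ℓ s) ℓ := by
  unfold energy
  exact (continuousAt_const.mul (continuousAt_const.div (continuousAt_id.pow 2)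
    (pow_ne_zero 2 hℓ)))

/-- The exponent is quadratic in `s + 1` with coefficient of order `ℓ⁻²`, so comparison of the
decreasing series with a Gaussian integral gives a bound linear in `ℓ`. Linearity is what makes sums
over gaps controllable through `∑ gap = L`. -/
lemma exp_energy_bound {β ℓ : ℝ} (hβ : 0 < β) (hℓ : 0 < ℓ) :
    Summable (fun s : ℕ => exp (-β * energy ℓ (s + 1))) ∧
      ∑' s : ℕ, exp (-β * energy ℓ (s + 1)) ≤ √(2 / (π * β)) / 2 * ℓ := by
  set b : ℝ := β * π ^ 2 / (2 * ℓ ^ 2) with hb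
  have hbpos : 0 < b := by positivity
  have hterm : ∀ s : ℕ, exp (-β * energy ℓ (s + 1)) = exp (-b * ((s + 1 : ℕ) : ℝ) ^ 2) := by
    intro s; congr 1; rw [energy, hb]; field_simp
  have hanti : AntitoneOn (fun x : ℝ => exp (-b * x ^ 2)) (Ici 0) := by
    intro x hx y _ hxy
    have hx' : (0 : ℝ) ≤ x := hx
    apply exp_le_exp.2
    have : x ^ 2 ≤ y ^ 2 := by gcongr
    nlinarith
  have hint : IntegrableOn (fun x : ℝ => exp (-b * x ^ 2)) (Ioi 0) :=
    (integrable_exp_neg_mul_sq hbpos).integrableOn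
  have hnn : ∀ t ∈ Ioi (0 : ℝ), 0 ≤ exp (-b * t ^ 2) := fun t _ => (exp_pos _).le
  simp_rw [hterm]
  refine ⟨?_, ?_⟩
  · have := hanti.summable_of_integrableOn_Ioi_zero hint hnn
    exact (summable_nat_add_iff 1).2 this
  · refine (hanti.tsum_add_one_le_integral hint hnn).trans_eq ?_
    rw [integral_gaussian_Ioi]
    have : π / b = 2 / (π * β) * ℓ ^ 2 := by rw [hb]; field_simp
    rw [this, sqrt_mul' _ (sq_nonneg ℓ), sqrt_sq hℓ.le]; ring

lemma occ_pos {β μ E : ℝ} (hβ : 0 < β) (h : μ < E) : 0 < occ β μ E := by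
  unfold occ
  have : 1 < exp (β * (E - μ)) := one_lt_exp_iff.2 (mul_pos hβ (sub_pos.2 h))
  exact one_div_pos.2 (by linarith)

lemma occ_lt_occ {β μ ν E : ℝ} (hβ : 0 < β) (h : μ < ν) (hE : ν < E) :
    occ β μ E < occ β ν E := by
  unfold occ
  have h1 : 1 < exp (β * (E - ν)) := one_lt_exp_iff.2 (mul_pos hβ (sub_pos.2 hE))
  have h2 : exp (β * (E - ν)) < exp (β * (E - μ)) :=
    exp_lt_exp.2 (mul_lt_mul_of_pos_left (by linarith) hβ)
  exact one_div_lt_one_div_of_lt (by linarith) (by linarith)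

lemma occ_mono {β μ ν E : ℝ} (hβ : 0 < β) (h : μ ≤ ν) (hE : ν < E) :
    occ β μ E ≤ occ β ν E := by
  rcases h.eq_or_lt with rfl | h
  · rfl
  · exact (occ_lt_occ hβ h hE).le

lemma occ_zero_le {β E : ℝ} (hβ : 0 < β) (hE : 0 < E) : occ β 0 E ≤ 1 / (β * E) := by
  unfold occ
  have := add_one_le_exp (β * (E - 0))
  have hp : 0 < β * E := mul_pos hβ hE
  exact one_div_le_one_div_of_le hp (by rw [sub_zero] at this ⊢; linarith)

lemma measurable_occ (β μ : ℝ) : Measurable (occ β μ) := by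
  unfold occ; fun_prop

lemma continuousAt_occ {β μ E : ℝ} (hβ : 0 < β) (h : μ < E) : ContinuousAt (occ β μ) E := by
  unfold occ
  have : 1 < exp (β * (E - μ)) := one_lt_exp_iff.2 (mul_pos hβ (sub_pos.2 h))
  refine continuousAt_const.div (by fun_prop) (by linarith)

lemma continuousAt_occ_left {β μ E : ℝ} (hβ : 0 < β) (h : μ < E) :
    ContinuousAt (fun μ => occ β μ E) μ := by
  unfold occ
  have : 1 < exp (β * (E - μ)) := one_lt_exp_iff.2 (mul_pos hβ (sub_pos.2 h))
  refine continuousAt_const.div (by fun_prop) (by linarith)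

/-- The constant in the Boltzmann bound `occ_le`. -/
def occConst (β ε μ : ℝ) : ℝ := exp (β * μ) / (1 - exp (-(β * (ε - μ))))

lemma occConst_pos {β ε μ : ℝ} (hβ : 0 < β) (h : μ < ε) : 0 < occConst β ε μ := by
  unfold occConst
  have : exp (-(β * (ε - μ))) < 1 := exp_lt_one_iff.2 (by nlinarith [mul_pos hβ (sub_pos.2 h)])
  exact div_pos (exp_pos _) (by linarith)

/-- Write the occupation number as `e^{-β(E-μ)} / (1 - e^{-β(E-μ)})`; the denominator is smallest at
`E = ε`. -/
lemma occ_le {β ε μ E : ℝ} (hβ : 0 < β) (h : μ < ε) (hE : ε ≤ E) :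
    occ β μ E ≤ occConst β ε μ * exp (-β * E) := by
  unfold occ occConst
  have hpos : 0 < β * (ε - μ) := mul_pos hβ (sub_pos.2 h)
  have h1 : exp (-(β * (ε - μ))) < 1 := exp_lt_one_iff.2 (by linarith)
  have h2 : 1 < exp (β * (E - μ)) :=
    one_lt_exp_iff.2 (mul_pos hβ (by linarith))
  have h3 : 1 ≤ exp (β * (E - μ)) * exp (-(β * (ε - μ))) := by
    rw [← exp_add]; apply one_le_exp; nlinarith
  have h4 : exp (β * μ) * exp (-β * E) * exp (β * (E - μ)) = 1 := by
    rw [← exp_add, ← exp_add, ← exp_zero]; congr 1; ring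
  rw [div_mul_eq_mul_div, div_le_div_iff₀ (by linarith) (by linarith), one_mul,
    mul_sub (exp (β * μ) * exp (-β * E)), mul_one, h4]
  have : 0 < exp (β * μ) * exp (-β * E) := by positivity
  nlinarith [mul_le_mul_of_nonneg_left h3 this.le]

/-- The difference factors exactly through the product of the two occupation numbers. Each of them
decays like `e^{-βE}`, and one of the two factors absorbs the `e^{βE}` that appears. Away from zero
energy this allows `μ_n` to be replaced by its limit `0`. -/
lemma occ_sub_le {β ε μ E : ℝ} (hβ : 0 < β) (h : μ < ε) (hε : 0 < ε) (hE : ε ≤ E) :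
    |occ β μ E - occ β 0 E| ≤
      occConst β ε μ * occConst β ε 0 * |1 - exp (-(β * μ))| * exp (-β * E) := by
  have e1 := occ_le hβ h hE
  have e2 := occ_le hβ hε hE
  have p1 := occ_pos hβ (h.trans_le hE)
  have p2 := occ_pos hβ (hε.trans_le hE)
  have key : occ β μ E - occ β 0 E = occ β μ E * occ β 0 E * (exp (β * E) * (1 - exp (-(β * μ)))) := by
    have h1 : 1 < exp (β * (E - μ)) := one_lt_exp_iff.2 (mul_pos hβ (by linarith))
    have h2 : 1 < exp (β * (E - 0)) := one_lt_exp_iff.2 (mul_pos hβ (by linarith))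
    have h3 : exp (β * E) * exp (-(β * μ)) = exp (β * (E - μ)) := by rw [← exp_add]; congr 1; ring
    have h4 : β * (E - 0) = β * E := by ring
    rw [h4] at h2
    rw [mul_sub, h3, mul_one]
    unfold occ
    rw [h4]
    have n1 : exp (β * (E - μ)) - 1 ≠ 0 := by linarith
    have n2 : exp (β * E) - 1 ≠ 0 := by linarith
    field_simp
    ring
  have h5 : exp (-β * E) * exp (β * E) = 1 := by rw [← exp_add, ← exp_zero]; congr 1; ring
  rw [key, abs_mul, abs_mul, abs_mul, abs_of_pos p1, abs_of_pos p2, abs_of_pos (exp_pos _)]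
  calc _ ≤ (occConst β ε μ * exp (-β * E)) * (occConst β ε 0 * exp (-β * E)) *
        (exp (β * E) * |1 - exp (-(β * μ))|) := by gcongr; exact p1.le.trans e1
    _ = occConst β ε μ * occConst β ε 0 * |1 - exp (-(β * μ))| * exp (-β * E) *
        (exp (-β * E) * exp (β * E)) := by ring
    _ = _ := by rw [h5, mul_one]

lemma summable_occ {β ℓ μ : ℝ} (hβ : 0 < β) (hℓ : 0 < ℓ) (hμ : μ < energy ℓ 1) :
    Summable (fun s : ℕ => occ β μ (energy ℓ (s + 1))) := by
  refine Summable.of_nonneg_of_le (fun s => (occ_pos hβ (hμ.trans_le (energy_one_le ℓ s))).le)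
    (fun s => occ_le hβ hμ (energy_one_le ℓ s)) ((exp_energy_bound hβ hℓ).1.mul_left _)

/-! ### Sums over the levels above a cutoff -/

/-- The sum over the levels above `ε`, with weights `a`, of the occupation numbers in an interval
of length `ℓ`. -/
def cutoffSum (β ε μ : ℝ) (a : ℝ → ℕ → ℝ) (ℓ : ℝ) : ℝ :=
  ∑' s : ℕ, (Ioi ε).indicator (occ β μ) (energy ℓ (s + 1)) * a ℓ s

/-- The thermodynamic limit of the density of `cutoffSum`. -/
def limCutoff (lam β ε μ : ℝ) (a : ℝ → ℕ → ℝ) : ℝ :=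
  lam ^ 2 * ∫ ℓ in Ioi (0 : ℝ), exp (-lam * ℓ) * cutoffSum β ε μ a ℓ

section Cutoff

variable {β ε μ ℓ : ℝ} {a : ℝ → ℕ → ℝ}

lemma indicator_occ_nonneg (hβ : 0 < β) (h : μ ≤ ε) (E : ℝ) :
    0 ≤ (Ioi ε).indicator (occ β μ) E :=
  indicator_nonneg (fun _ hE => (occ_pos hβ (h.trans_lt hE)).le) E

lemma indicator_occ_le (hβ : 0 < β) (h : μ < ε) (E : ℝ) :
    (Ioi ε).indicator (occ β μ) E ≤ occConst β ε μ * exp (-β * E) := by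
  refine indicator_apply_le' (fun hE => occ_le hβ h (le_of_lt hE)) fun _ => ?_
  exact (mul_pos (occConst_pos hβ h) (exp_pos _)).le

lemma abs_indicator_mul_le (hβ : 0 < β) (h : μ ≤ ε) (E : ℝ) {w : ℝ} (hw : |w| ≤ 1) :
    |(Ioi ε).indicator (occ β μ) E * w| ≤ (Ioi ε).indicator (occ β μ) E := by
  rw [abs_mul, abs_of_nonneg (indicator_occ_nonneg hβ h E)]
  exact mul_le_of_le_one_right (indicator_occ_nonneg hβ h E) hw

lemma summable_indicator_occ (hβ : 0 < β) (h : μ < ε) (hℓ : 0 < ℓ) :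
    Summable (fun s : ℕ => (Ioi ε).indicator (occ β μ) (energy ℓ (s + 1))) :=
  Summable.of_nonneg_of_le (fun _ => indicator_occ_nonneg hβ h.le _)
    (fun _ => indicator_occ_le hβ h _) ((exp_energy_bound hβ hℓ).1.mul_left _)

lemma summable_cutoff (hβ : 0 < β) (h : μ < ε) (hℓ : 0 < ℓ) (ha : ∀ s, |a ℓ s| ≤ 1) :
    Summable (fun s : ℕ => (Ioi ε).indicator (occ β μ) (energy ℓ (s + 1)) * a ℓ s) :=
  Summable.of_norm_bounded (summable_indicator_occ hβ h hℓ)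
    (fun s => abs_indicator_mul_le hβ h.le _ (ha s))

lemma measurable_cutoffSum (ha : ∀ s, Measurable (fun ℓ => a ℓ s)) :
    Measurable (cutoffSum β ε μ a) := by
  unfold cutoffSum
  exact Measurable.tsum fun s =>
    ((((measurable_occ β μ).indicator measurableSet_Ioi).comp (measurable_energy (s + 1))).mul
      (ha s))

lemma abs_cutoffSum_le (hβ : 0 < β) (h : μ < ε) (hℓ : 0 < ℓ) (ha : ∀ s, |a ℓ s| ≤ 1) :
    |cutoffSum β ε μ a ℓ| ≤ occConst β ε μ * (√(2 / (π * β)) / 2) * ℓ := by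
  have hb := exp_energy_bound hβ hℓ
  have := tsum_of_norm_bounded (f := fun s : ℕ => (Ioi ε).indicator (occ β μ) (energy ℓ (s + 1)) *
    a ℓ s) ((hb.1.mul_left (occConst β ε μ)).hasSum) (fun s =>
      (abs_indicator_mul_le hβ h.le _ (ha s)).trans (indicator_occ_le hβ h _))
  rw [tsum_mul_left] at this
  refine this.trans ?_
  rw [mul_assoc]
  exact mul_le_mul_of_nonneg_left hb.2 (occConst_pos hβ h).le

lemma abs_cutoffSum_sub_le (hβ : 0 < β) (h : μ < ε) (hε : 0 < ε) (hℓ : 0 < ℓ)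
    (ha : ∀ s, |a ℓ s| ≤ 1) :
    |cutoffSum β ε μ a ℓ - cutoffSum β ε 0 a ℓ| ≤
      occConst β ε μ * occConst β ε 0 * |1 - exp (-(β * μ))| * (√(2 / (π * β)) / 2) * ℓ := by
  have hb := exp_energy_bound hβ hℓ
  set K := occConst β ε μ * occConst β ε 0 * |1 - exp (-(β * μ))| with hK
  have hKnn : 0 ≤ K := mul_nonneg (mul_pos (occConst_pos hβ h) (occConst_pos hβ hε)).le (abs_nonneg _)
  unfold cutoffSum
  rw [← (summable_cutoff hβ h hℓ ha).tsum_sub (summable_cutoff hβ hε hℓ ha)]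
  have := tsum_of_norm_bounded (f := fun s : ℕ =>
    (Ioi ε).indicator (occ β μ) (energy ℓ (s + 1)) * a ℓ s -
    (Ioi ε).indicator (occ β 0) (energy ℓ (s + 1)) * a ℓ s) ((hb.1.mul_left K).hasSum) (fun s => by
      rw [← sub_mul, norm_mul]
      refine (mul_le_of_le_one_right (norm_nonneg _) (ha s)).trans ?_
      by_cases hE : energy ℓ (s + 1) ∈ Ioi ε
      · rw [indicator_of_mem hE, indicator_of_mem hE]
        exact occ_sub_le hβ h hε (le_of_lt hE)
      · rw [indicator_of_notMem hE, indicator_of_notMem hE, sub_zero, norm_zero]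
        positivity)
  rw [tsum_mul_left] at this
  refine this.trans ?_
  rw [mul_assoc K]
  exact mul_le_mul_of_nonneg_left hb.2 hKnn

/-- The indicator jumps only at lengths for which some level hits `ε` exactly. For lengths below `2
* ℓ` the levels of the interval of length `2 * ℓ` are the lowest, so they give a summable bound
uniform near `ℓ`. -/
lemma continuousAt_cutoffSum (hβ : 0 < β) (h : μ < ε) (hℓ : 0 < ℓ)
    (ha : ∀ m, 0 < m → ∀ s, |a m s| ≤ 1) (hac : ∀ s, ContinuousAt (fun m => a m s) ℓ)
    (hne : ∀ s : ℕ, energy ℓ (s + 1) ≠ ε) :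
    ContinuousAt (cutoffSum β ε μ a) ℓ := by
  unfold cutoffSum
  refine tendsto_tsum_of_dominated_convergence
    (bound := fun s : ℕ => occConst β ε μ * exp (-β * energy (2 * ℓ) (s + 1)))
    ((exp_energy_bound hβ (by positivity : 0 < 2 * ℓ)).1.mul_left _) (fun s => ?_) ?_
  · refine Tendsto.mul ?_ (hac s)
    have hE := continuousAt_energy hℓ.ne' (s + 1)
    rcases lt_or_gt_of_ne (hne s) with hlt | hgt
    · rw [indicator_of_notMem (show energy ℓ (s + 1) ∉ Ioi ε from not_lt.2 hlt.le)]
      refine tendsto_const_nhds.congr' ?_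
      filter_upwards [hE.eventually_lt_const hlt] with m hm
      rw [indicator_of_notMem (show energy m (s + 1) ∉ Ioi ε from not_lt.2 (le_of_lt hm))]
    · rw [indicator_of_mem (show energy ℓ (s + 1) ∈ Ioi ε from hgt)]
      refine Tendsto.congr' ?_ (ContinuousAt.comp (f := fun m => energy m (s + 1))
        (continuousAt_occ hβ (h.trans hgt)) hE)
      filter_upwards [hE.eventually_const_lt hgt] with m hm
      rw [indicator_of_mem (show energy m (s + 1) ∈ Ioi ε from hm)]; rfl
  · filter_upwards [Ioo_mem_nhds (show (0:ℝ) < ℓ from hℓ) (show ℓ < 2 * ℓ by linarith)] with m hm s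
    refine (abs_indicator_mul_le hβ h.le _ (ha m hm.1 s)).trans
      ((indicator_occ_le hβ h _).trans ?_)
    have := energy_anti hm.1 hm.2.le (s + 1)
    have hc := (occConst_pos hβ h).le
    gcongr ?_ * exp ?_
    nlinarith

lemma ae_energy_ne (ε : ℝ) : ∀ᵐ ℓ ∂(volume.restrict (Ioi (0 : ℝ))), ∀ s : ℕ,
    energy ℓ (s + 1) ≠ ε := by
  rw [ae_all_iff]
  intro s
  rw [ae_restrict_iff' measurableSet_Ioi]
  have hsub : {ℓ : ℝ | 0 < ℓ ∧ energy ℓ (s + 1) = ε}.Subsingleton := by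
    rintro x ⟨hx, hxe⟩ y ⟨hy, hye⟩
    have h1 : energy x (s + 1) = energy y (s + 1) := by rw [hxe, hye]
    unfold energy at h1
    push_cast at h1
    have hs : (0 : ℝ) < π ^ 2 * ((s : ℝ) + 1) ^ 2 := by positivity
    have h2 : x ^ 2 = y ^ 2 := by
      field_simp at h1
      linarith
    exact (sq_eq_sq₀ hx.le hy.le).1 h2
  have h0 := hsub.countable.measure_zero volume
  rw [ae_iff]
  refine measure_mono_null (fun ℓ hℓ => ?_) h0
  simp only [mem_ofPred_eq, Classical.not_imp, not_not] at hℓ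
  exact hℓ

/-! Domination uniform in `ε ≥ 0` and `μ ≤ 0`. -/

/-- From `e^y - 1 ≥ y` the occupation number is at most `1 / (βE)`, of order `ℓ² / (s + 1)²`. The
bound survives `ε = μ = 0`, but it is quadratic in `ℓ`: enough against the weight `e^{-λℓ}`, too
weak for `tendsto_sum_gaps`. -/
lemma indicator_occ_le_sq (hβ : 0 < β) (hμ : μ ≤ 0) (hℓ : 0 < ℓ) (s : ℕ) :
    (Ioi ε).indicator (occ β μ) (energy ℓ (s + 1)) ≤
      2 / (β * π ^ 2) * (1 / ((s : ℝ) + 1) ^ 2) * ℓ ^ 2 := by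
  have hE := energy_pos hℓ s
  have h0 : occ β 0 (energy ℓ (s + 1)) ≤ 2 / (β * π ^ 2) * (1 / ((s : ℝ) + 1) ^ 2) * ℓ ^ 2 := by
    refine (occ_zero_le hβ hE).trans_eq ?_
    unfold energy; push_cast; field_simp
  refine indicator_apply_le' (fun _ => (occ_mono hβ hμ hE).trans h0) fun _ => by positivity

lemma summable_one_div_succ_sq : Summable (fun s : ℕ => 1 / ((s : ℝ) + 1) ^ 2) := by
  have := (summable_nat_add_iff 1).2 (Real.summable_one_div_nat_pow.2 (by norm_num : 1 < 2))
  simpa using this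

/-- The constant in the quadratic bound for `cutoffSum`. -/
def sqConst (β : ℝ) : ℝ := 2 / (β * π ^ 2) * ∑' s : ℕ, 1 / ((s : ℝ) + 1) ^ 2

lemma abs_cutoffSum_le_sq (hβ : 0 < β) (hε : 0 ≤ ε) (hμ : μ ≤ 0) (hℓ : 0 < ℓ)
    (ha : ∀ s, |a ℓ s| ≤ 1) : |cutoffSum β ε μ a ℓ| ≤ sqConst β * ℓ ^ 2 := by
  have := tsum_of_norm_bounded (f := fun s : ℕ => (Ioi ε).indicator (occ β μ) (energy ℓ (s + 1)) *
    a ℓ s) (((summable_one_div_succ_sq.mul_left (2 / (β * π ^ 2))).mul_right (ℓ ^ 2)).hasSum)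
    (fun s => (abs_indicator_mul_le hβ (hμ.trans hε) _ (ha s)).trans
      (indicator_occ_le_sq hβ hμ hℓ s))
  rw [tsum_mul_right, tsum_mul_left] at this
  exact this

lemma integrableOn_exp_mul_sq {lam : ℝ} (hlam : 0 < lam) (K : ℝ) :
    IntegrableOn (fun ℓ : ℝ => exp (-lam * ℓ) * (K * ℓ ^ 2)) (Ioi 0) := by
  have := integrableOn_rpow_mul_exp_neg_mul_rpow (p := 1) (s := 2) (by norm_num) one_pos hlam
  refine (this.const_mul K).congr ?_
  filter_upwards with ℓ
  simp only [rpow_one, rpow_two]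
  ring

lemma norm_exp_mul_cutoffSum_le (lam : ℝ) (hβ : 0 < β) (hε : 0 ≤ ε) (hμ : μ ≤ 0) (hℓ : 0 < ℓ)
    (ha : ∀ s, |a ℓ s| ≤ 1) :
    ‖exp (-lam * ℓ) * cutoffSum β ε μ a ℓ‖ ≤ exp (-lam * ℓ) * (sqConst β * ℓ ^ 2) := by
  rw [norm_mul, norm_of_nonneg (exp_pos _).le]
  exact mul_le_mul_of_nonneg_left (abs_cutoffSum_le_sq hβ hε hμ hℓ ha) (exp_pos _).le

lemma integrableOn_exp_mul_cutoffSum {lam : ℝ} (hlam : 0 < lam) (hβ : 0 < β) (hε : 0 ≤ ε)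
    (hμ : μ ≤ 0) (ham : ∀ s, Measurable (fun ℓ => a ℓ s)) (ha : ∀ m, 0 < m → ∀ s, |a m s| ≤ 1) :
    IntegrableOn (fun ℓ => exp (-lam * ℓ) * cutoffSum β ε μ a ℓ) (Ioi 0) := by
  refine (integrableOn_exp_mul_sq hlam (sqConst β)).mono' ?_ ?_
  · exact ((by fun_prop : Measurable fun ℓ : ℝ => exp (-lam * ℓ)).mul
      (measurable_cutoffSum ham)).aestronglyMeasurable
  · filter_upwards [ae_restrict_mem measurableSet_Ioi] with ℓ hℓ
    exact norm_exp_mul_cutoffSum_le lam hβ hε hμ hℓ (ha ℓ hℓ)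

/-- Dominated convergence for `limCutoff`, in all of its parameters. -/
lemma tendsto_limCutoff {ι : Type*} {F : Filter ι} [F.IsCountablyGenerated] {lam : ℝ}
    (hlam : 0 < lam) (hβ : 0 < β)
    {e m : ι → ℝ} {w : ι → ℝ → ℕ → ℝ} (he : ∀ᶠ i in F, 0 ≤ e i) (hm : ∀ᶠ i in F, m i ≤ 0)
    (hwm : ∀ i s, Measurable (fun ℓ => w i ℓ s)) (hw : ∀ i ℓ, 0 < ℓ → ∀ s, |w i ℓ s| ≤ 1)
    (hlim : ∀ ℓ, 0 < ℓ → ∀ s : ℕ, Tendsto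
      (fun i => (Ioi (e i)).indicator (occ β (m i)) (energy ℓ (s + 1)) * w i ℓ s) F
      (𝓝 ((Ioi ε).indicator (occ β μ) (energy ℓ (s + 1)) * a ℓ s))) :
    Tendsto (fun i => limCutoff lam β (e i) (m i) (w i)) F (𝓝 (limCutoff lam β ε μ a)) := by
  unfold limCutoff
  refine Tendsto.const_mul _ ?_
  refine tendsto_integral_filter_of_dominated_convergence
    (fun ℓ => exp (-lam * ℓ) * (sqConst β * ℓ ^ 2)) ?_ ?_ (integrableOn_exp_mul_sq hlam _) ?_
  · filter_upwards with i
    exact ((by fun_prop : Measurable fun ℓ : ℝ => exp (-lam * ℓ)).mul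
      (measurable_cutoffSum (hwm i))).aestronglyMeasurable
  · filter_upwards [he, hm] with i hi hi'
    filter_upwards [ae_restrict_mem measurableSet_Ioi] with ℓ hℓ
    exact norm_exp_mul_cutoffSum_le lam hβ hi hi' hℓ (hw i ℓ hℓ)
  · filter_upwards [ae_restrict_mem measurableSet_Ioi] with ℓ hℓ
    refine Tendsto.const_mul _ ?_
    refine tendsto_tsum_of_dominated_convergence
      ((summable_one_div_succ_sq.mul_left (2 / (β * π ^ 2))).mul_right (ℓ ^ 2)) (hlim ℓ hℓ) ?_
    filter_upwards [he, hm] with i hi hi' s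
    exact (abs_indicator_mul_le hβ (hi'.trans hi) _ (hw i ℓ hℓ s)).trans
      (indicator_occ_le_sq hβ hi' hℓ s)

end Cutoff

/-! ### Overlap of an eigenfunction with its translate -/

/-- The overlap of the `s + 1`-st eigenfunction on an interval of length `ℓ` with its translate
by `d ≥ 0`. -/
def overlap (d ℓ : ℝ) (s : ℕ) : ℝ :=
  if d ≤ ℓ then (1 - d / ℓ) * cos (π * (s + 1) / ℓ * d) +
    sin (π * (s + 1) / ℓ * d) / (π * (s + 1)) else 0

lemma measurable_overlap (d : ℝ) (s : ℕ) : Measurable (fun ℓ => overlap d ℓ s) := by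
  unfold overlap
  refine Measurable.ite measurableSet_Ici (by fun_prop) measurable_const

lemma abs_sin_div_le {d ℓ : ℝ} (hd : 0 ≤ d) (hℓ : 0 < ℓ) (s : ℕ) :
    |sin (π * (s + 1) / ℓ * d) / (π * (s + 1))| ≤ d / ℓ := by
  have hs : 0 < π * ((s : ℝ) + 1) := by positivity
  rw [abs_div, abs_of_pos hs, div_le_iff₀ hs]
  refine abs_sin_le_abs.trans_eq ?_
  rw [abs_of_nonneg (by positivity)]
  ring

/-- The cosine term is at most `1 - d / ℓ` and the sine term at most `d / ℓ`. -/
lemma abs_overlap_le {d ℓ : ℝ} (hd : 0 ≤ d) (hℓ : 0 < ℓ) (s : ℕ) : |overlap d ℓ s| ≤ 1 := by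
  unfold overlap
  split_ifs with h
  · have h1 : 0 ≤ 1 - d / ℓ := sub_nonneg.2 ((div_le_one hℓ).2 h)
    have h2 := abs_sin_div_le hd hℓ s
    have h3 : |(1 - d / ℓ) * cos (π * (s + 1) / ℓ * d)| ≤ 1 - d / ℓ := by
      rw [abs_mul, abs_of_nonneg h1]
      exact mul_le_of_le_one_right h1 (abs_cos_le_one _)
    refine (abs_add_le _ _).trans ?_
    linarith
  · simp

lemma continuousAt_overlap {d ℓ : ℝ} (hℓ : 0 < ℓ) (hne : ℓ ≠ d) (s : ℕ) :
    ContinuousAt (fun m => overlap d m s) ℓ := by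
  rcases lt_or_gt_of_ne hne with h | h
  · refine (continuousAt_const (y := (0 : ℝ))).congr ?_
    filter_upwards [Iio_mem_nhds h] with m hm
    rw [overlap, if_neg (not_le.2 hm)]
  · have : ContinuousAt (fun ℓ => (1 - d / ℓ) * cos (π * (s + 1) / ℓ * d) +
      sin (π * (s + 1) / ℓ * d) / (π * (s + 1))) ℓ := by
      have h1 : ContinuousAt (fun ℓ => d / ℓ) ℓ := continuousAt_const.div continuousAt_id hℓ.ne'
      have h2 : ContinuousAt (fun ℓ => π * (s + 1) / ℓ * d) ℓ :=
        (continuousAt_const.div continuousAt_id hℓ.ne').mul continuousAt_const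
      have h3 := Real.continuous_cos.continuousAt.comp h2
      have h4 := Real.continuous_sin.continuousAt.comp h2
      exact ((continuousAt_const.sub h1).mul h3).add (h4.div_const _)
    refine this.congr ?_
    filter_upwards [Ioi_mem_nhds h] with m hm
    rw [overlap, if_pos (le_of_lt hm)]

/-- A low level forces a long interval, because even the ground energy `π² / (2ℓ²)` exceeds `1 /
ℓ²`. -/
lemma inv_le_sqrt_of_energy_le {ℓ ε : ℝ} (hℓ : 0 < ℓ) (s : ℕ) (hE : energy ℓ (s + 1) ≤ ε) :
    1 / ℓ ≤ √ε := by
  apply le_sqrt_of_sq_le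
  refine le_trans ?_ ((energy_one_le ℓ s).trans hE)
  unfold energy
  rw [div_pow, ← mul_div_assoc]
  gcongr
  push_cast
  nlinarith [pi_gt_three]

/-- Overlaps of low-energy eigenfunctions are close to `1`. -/
lemma abs_overlap_sub_one_le {d ℓ ε : ℝ} (hd : 0 ≤ d) (hℓ : 0 < ℓ) (s : ℕ)
    (hE : energy ℓ (s + 1) ≤ ε) : |overlap d ℓ s - 1| ≤ d ^ 2 * ε + 2 * d * √ε := by
  have hE0 := energy_pos hℓ s
  have hε : 0 < ε := hE0.trans_le hE
  set k := π * (s + 1) / ℓ with hk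
  have hk2 : k ^ 2 / 2 ≤ ε := by
    refine le_trans (le_of_eq ?_) hE
    rw [hk, energy]; push_cast; field_simp
  have hinv : 1 / ℓ ≤ √ε := inv_le_sqrt_of_energy_le hℓ s hE
  have hdl : d / ℓ ≤ d * √ε := by
    rw [div_eq_mul_one_div]; gcongr
  by_cases h : d ≤ ℓ
  · rw [overlap, if_pos h]
    have h1 : 0 ≤ d / ℓ := by positivity
    have h1' : 0 ≤ 1 - d / ℓ := sub_nonneg.2 ((div_le_one hℓ).2 h)
    have h2 := abs_le.1 (abs_sin_div_le hd hℓ s)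
    have h4 := one_sub_sq_div_two_le_cos (x := k * d)
    have h5 := cos_le_one (k * d)
    have h6 : (k * d) ^ 2 / 2 ≤ d ^ 2 * ε := by nlinarith [sq_nonneg d]
    rw [abs_le]
    constructor <;> nlinarith [h2.1, h2.2]
  -- Here the overlap is `0`, and the claimed error exceeds `1` because `1 < d / ℓ ≤ d * √ε`.
  · rw [overlap, if_neg h]
    push Not at h
    have : 1 < d / ℓ := (one_lt_div hℓ).2 h
    have h8 : 0 ≤ d ^ 2 * ε := by positivity
    have h9 : 0 ≤ d * √ε := by positivity
    rw [zero_sub, abs_neg, abs_one]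
    linarith

/-! ### The bounded difference inequality -/

/-- McDiarmid's inequality, as a bound for the moment generating function: a bounded measurable
function of `N` i.i.d. variables which changes by at most `c` when one variable is changed is
sub-Gaussian. -/
lemma hasSubgaussianMGF_pi_of_bounded_differences {α : Type*} [MeasurableSpace α] (ν : Measure α)
    [IsProbabilityMeasure ν] (c : NNReal) : ∀ (N : ℕ) (F : (Fin N → α) → ℝ), Measurable F →
    (∃ C, ∀ x, |F x| ≤ C) → (∀ x i y, |F (Function.update x i y) - F x| ≤ c) →
    HasSubgaussianMGF (fun x => F x - ∫ x, F x ∂(Measure.pi fun _ => ν)) (N * c ^ 2)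
      (Measure.pi fun _ => ν)
  | 0, F, _, _, _ => by
    have : (fun x => F x - ∫ x, F x ∂(Measure.pi fun _ : Fin 0 => ν)) = fun _ => 0 := by
      funext x
      have : F = fun _ => F x := funext fun y => congrArg F (Subsingleton.elim _ _)
      rw [this]; simp
    rw [this]
    simp
  | N + 1, F, hF, ⟨C, hC⟩, hc => by
    set π' : Measure (Fin N → α) := Measure.pi fun _ => ν with hπ'
    set G : α × (Fin N → α) → ℝ := fun p => F (Fin.cons p.1 p.2) with hG
    have hmp : MeasurePreserving (MeasurableEquiv.piFinSuccAbove (fun _ => α) 0)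
        (Measure.pi fun _ : Fin (N + 1) => ν) (ν.prod π') :=
      measurePreserving_piFinSuccAbove (fun _ => ν) 0
    have hFG : ∀ x, F x = G (MeasurableEquiv.piFinSuccAbove (fun _ => α) 0 x) := by
      intro x
      simp only [hG]
      congr 1
      exact (Fin.cons_self_tail x).symm
    have hGm : Measurable G := by
      have : G = F ∘ (MeasurableEquiv.piFinSuccAbove (fun _ => α) 0).symm := by
        funext p
        simp only [Function.comp, hFG, MeasurableEquiv.apply_symm_apply]
      rw [this]
      exact hF.comp (MeasurableEquiv.measurable _)
    have hGb : ∀ p, |G p| ≤ C := fun p => hC _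
    have hGi : Integrable G (ν.prod π') :=
      Integrable.of_bound hGm.aestronglyMeasurable C (Eventually.of_forall hGb)
    have hGi' : ∀ x, Integrable (fun y => G (y, x)) ν := fun x =>
      Integrable.of_bound (hGm.comp measurable_prodMk_right).aestronglyMeasurable C
        (Eventually.of_forall fun y => hGb _)
    -- Induction on the number of variables: averaging over the first one keeps the bounded
    -- differences, so `H` satisfies the induction hypothesis, and only the fluctuation of `G - H`
    -- in the first variable remains.
    set H : (Fin N → α) → ℝ := fun x => ∫ y, G (y, x) ∂ν with hH
    have hHm : Measurable H :=
      (StronglyMeasurable.integral_prod_left (f := fun y x => G (y, x))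
        hGm.stronglyMeasurable).measurable
    have hHb : ∀ x, |H x| ≤ C := fun x => by
      have := norm_integral_le_of_norm_le_const (μ := ν) (f := fun y => G (y, x)) (C := C)
        (Eventually.of_forall fun y => hGb _)
      simpa using this
    have hHc : ∀ x i y, |H (Function.update x i y) - H x| ≤ c := fun x i y => by
      have h1 : H (Function.update x i y) - H x =
          ∫ z, (G (z, Function.update x i y) - G (z, x)) ∂ν :=
        (integral_sub (hGi' _) (hGi' _)).symm
      have := norm_integral_le_of_norm_le_const (μ := ν)
        (f := fun z => G (z, Function.update x i y) - G (z, x)) (C := c)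
        (Eventually.of_forall fun z => by
          simp only [hG, Fin.cons_update]
          exact hc _ _ _)
      rw [h1]
      simpa using this
    have ih := hasSubgaussianMGF_pi_of_bounded_differences ν c N H hHm ⟨C, hHb⟩ hHc
    have hmean : ∫ x, F x ∂(Measure.pi fun _ => ν) = ∫ x, H x ∂π' := by
      simp_rw [hFG]
      rw [hmp.integral_comp' (g := G), integral_prod_symm G hGi]
    set M := ∫ x, H x ∂π' with hM
    have hcond : ∀ x, HasSubgaussianMGF (fun y => G (y, x) - H x) (c ^ 2) ν := fun x => by
      obtain ⟨y₀⟩ : Nonempty α := nonempty_of_isProbabilityMeasure ν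
      -- Hoeffding's lemma on an interval of length `2c` centred at an arbitrary value of `G` gives
      -- the variance proxy `c²`. The sharper `c² / 4` is not needed.
      have := hasSubgaussianMGF_of_mem_Icc (μ := ν) (X := fun y => G (y, x))
        (a := G (y₀, x) - c) (b := G (y₀, x) + c)
        (hGm.comp measurable_prodMk_right).aemeasurable (Eventually.of_forall fun y => by
          have := hc (Fin.cons y₀ x : Fin (N + 1) → α) 0 y
          rw [Fin.update_cons_zero] at this
          have := abs_le.1 this
          simp only [hG]
          constructor <;> linarith)
      convert! this using 2
      ext
      simp only [add_sub_sub_cancel, NNReal.coe_div, coe_nnnorm, NNReal.coe_ofNat]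
      rw [norm_of_nonneg (by positivity)]
      ring
    have hint : ∀ t : ℝ, Integrable (fun p => exp (t * (G p - M))) (ν.prod π') := fun t => by
      refine Integrable.of_bound (by fun_prop) (exp (|t| * (C + |M|))) (Eventually.of_forall fun p => ?_)
      rw [norm_of_nonneg (exp_pos _).le]
      apply exp_le_exp.2
      refine (le_abs_self _).trans ?_
      rw [abs_mul]
      gcongr
      exact (abs_sub _ _).trans (by gcongr; exact hGb p)
    rw [hmean]
    constructor
    · intro t
      have := hmp.integrable_comp_of_integrable (hint t)
      refine this.congr (Eventually.of_forall fun x => ?_)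
      simp only [Function.comp, hFG]
    · intro t
      have h1 : mgf (fun x => F x - M) (Measure.pi fun _ => ν) t =
          ∫ p, exp (t * (G p - M)) ∂(ν.prod π') := by
        unfold mgf
        simp_rw [hFG]
        exact hmp.integral_comp' (g := fun p => exp (t * (G p - M)))
      rw [h1, integral_prod_symm _ (hint t)]
      -- Conditionally on the other variables, `H x - M` is constant and the inner integral is the
      -- moment generating function of `G - H`.
      have h2 : ∀ x, ∫ y, exp (t * (G (y, x) - M)) ∂ν ≤
          exp (c ^ 2 * t ^ 2 / 2) * exp (t * (H x - M)) := fun x => by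
        have := (hcond x).mgf_le t
        unfold mgf at this
        have e : ∀ y, exp (t * (G (y, x) - M)) =
            exp (t * (G (y, x) - H x)) * exp (t * (H x - M)) := fun y => by
          rw [← exp_add]; ring_nf
        simp_rw [e]
        rw [integral_mul_const]
        push_cast at this
        gcongr
      have h3 : ∫ x, ∫ y, exp (t * (G (y, x) - M)) ∂ν ∂π' ≤
          ∫ x, exp (c ^ 2 * t ^ 2 / 2) * exp (t * (H x - M)) ∂π' :=
        integral_mono (hint t).integral_prod_right ((ih.integrable_exp_mul t).const_mul _) h2
      refine h3.trans ?_
      rw [integral_const_mul]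
      have := ih.mgf_le t
      unfold mgf at this
      calc _ ≤ exp (c ^ 2 * t ^ 2 / 2) * exp (((N * c ^ 2 : NNReal) : ℝ) * t ^ 2 / 2) := by gcongr
        _ = _ := by rw [← exp_add]; push_cast; ring_nf

lemma measure_abs_sub_ge_le_of_bounded_differences {α : Type*} [MeasurableSpace α] (ν : Measure α)
    [IsProbabilityMeasure ν] (c : NNReal) (N : ℕ) (F : (Fin N → α) → ℝ) (hF : Measurable F)
    (hb : ∃ C, ∀ x, |F x| ≤ C) (hc : ∀ x i y, |F (Function.update x i y) - F x| ≤ c)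
    {η : ℝ} (hη : 0 ≤ η) :
    (Measure.pi fun _ => ν).real {x | η ≤ |F x - ∫ x, F x ∂(Measure.pi fun _ => ν)|} ≤
      2 * exp (-η ^ 2 / (2 * (N * c ^ 2))) := by
  have h := hasSubgaussianMGF_pi_of_bounded_differences ν c N F hF hb hc
  have h1 := h.measure_ge_le hη
  have h2 := h.neg.measure_ge_le hη
  push_cast at h1 h2
  set M := ∫ x, F x ∂(Measure.pi fun _ => ν)
  have hsub : {x | η ≤ |F x - M|} ⊆ {x | η ≤ F x - M} ∪ {x | η ≤ (-fun x => F x - M) x} := by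
    intro x hx
    simp only [mem_ofPred_eq, mem_union, Pi.neg_apply] at hx ⊢
    exact le_abs.1 hx
  refine (measureReal_mono hsub).trans ((measureReal_union_le _ _).trans ?_)
  linarith

/-! ### Geometry of the partition -/

section Partition

variable {N : ℕ} {L : ℝ} {x : Fin N → ℝ}

lemma node_zero : node L x 0 = -L / 2 := rfl

lemma node_last : node L x (Fin.last (N + 1)) = L / 2 := by
  rw [← Fin.succ_last, node, Fin.cons_succ, Fin.snoc_last]

lemma node_castSucc_succ (i : Fin N) : node L x i.castSucc.succ = x (Tuple.sort x i) := by
  rw [node, Fin.cons_succ, Fin.snoc_castSucc]; rfl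

/-- Sorting only makes the nodes weakly increasing; injectivity excludes equal neighbours and the
open box excludes impurities at the two ends. -/
lemma gap_pos_of_injective (hL : 0 < L) (hinj : Function.Injective x)
    (hbox : ∀ i, x i ∈ Ioo (-L / 2) (L / 2)) (j : Fin (N + 1)) : 0 < gap L x j := by
  unfold gap
  rw [sub_pos, left, right]
  induction j using Fin.cases with
  | zero =>
    rw [Fin.castSucc_zero, node_zero]
    induction N using Nat.casesOn with
    | zero =>
      have : (Fin.succ 0 : Fin (0 + 2)) = Fin.last (0 + 1) := rfl
      rw [this, node_last]; linarith
    | succ n =>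
      have : (Fin.succ 0 : Fin (n + 1 + 2)) = (0 : Fin (n + 1)).castSucc.succ := rfl
      rw [this, node_castSucc_succ]; exact (hbox _).1
  | succ j' =>
    rw [← Fin.succ_castSucc, node_castSucc_succ]
    by_cases hl : j'.succ = Fin.last N
    · rw [hl, Fin.succ_last, node_last]; exact (hbox _).2
    · obtain ⟨k, hk⟩ := Fin.exists_castSucc_eq.2 hl
      rw [← hk, node_castSucc_succ]
      have hlt : j' < k := by
        have : j'.castSucc < k.castSucc := by rw [hk]; exact Fin.castSucc_lt_succ
        exact Fin.castSucc_lt_castSucc_iff.1 this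
      refine lt_of_le_of_ne (Tuple.monotone_sort x hlt.le) fun h => hlt.ne ?_
      exact (Tuple.sort x).injective (hinj h)

lemma sum_gap : ∑ j, gap L x j = L := by
  unfold gap left right
  rw [Finset.sum_sub_distrib]
  have h1 := Fin.sum_univ_succ (node L x)
  have h2 := Fin.sum_univ_castSucc (node L x)
  rw [node_zero] at h1
  rw [node_last] at h2
  linarith

lemma strictMono_node (hg : ∀ j, 0 < gap L x j) : StrictMono (node L x) :=
  Fin.strictMono_iff_lt_succ.2 fun j => sub_pos.1 (hg j)

lemma left_lt_right (hg : ∀ j, 0 < gap L x j) (j : Fin (N + 1)) : left L x j < right L x j :=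
  sub_pos.1 (hg j)

lemma neg_half_le_left (hg : ∀ j, 0 < gap L x j) (j : Fin (N + 1)) : -L / 2 ≤ left L x j :=
  node_zero (x := x) ▸ (strictMono_node hg).monotone (Fin.zero_le _)

lemma right_le_half (hg : ∀ j, 0 < gap L x j) (j : Fin (N + 1)) : right L x j ≤ L / 2 :=
  node_last (x := x) ▸ (strictMono_node hg).monotone (Fin.le_last _)

lemma right_le_left (hg : ∀ j, 0 < gap L x j) {j k : Fin (N + 1)} (h : j < k) :
    right L x j ≤ left L x k :=
  (strictMono_node hg).monotone (Fin.castSucc_lt_iff_succ_le.1 (Fin.castSucc_lt_castSucc_iff.2 h))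

lemma exists_mem_Ico {z : ℝ} (h1 : -L / 2 ≤ z) (h2 : z < L / 2) :
    ∃ j : Fin (N + 1), left L x j ≤ z ∧ z < right L x j := by
  by_contra! h
  have : ∀ k : Fin (N + 2), node L x k ≤ z := by
    intro k
    induction k using Fin.induction with
    | zero => exact h1
    | succ i ih => exact h i ih
  have := this (Fin.last _)
  rw [node_last] at this
  linarith

lemma point_notMem (hg : ∀ j, 0 < gap L x j) (i : Fin N) (j : Fin (N + 1)) :
    x i ≤ left L x j ∨ right L x j ≤ x i := by
  have hi : x i = node L x ((Tuple.sort x).symm i).castSucc.succ := by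
    rw [node_castSucc_succ, Equiv.apply_symm_apply]
  rw [hi]
  rcases le_or_gt (((Tuple.sort x).symm i).castSucc.succ) j.castSucc with h | h
  · exact Or.inl ((strictMono_node hg).monotone h)
  · exact Or.inr ((strictMono_node hg).monotone (Fin.castSucc_lt_iff_succ_le.1 h))

lemma right_eq_point_or_half (j : Fin (N + 1)) :
    right L x j = L / 2 ∨ ∃ i, right L x j = x i := by
  unfold right
  by_cases hl : j = Fin.last N
  · left; rw [hl, Fin.succ_last, node_last]
  · obtain ⟨k, hk⟩ := Fin.exists_castSucc_eq.2 hl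
    right; exact ⟨_, by rw [← hk, node_castSucc_succ]⟩

end Partition

/-- The set of the windows `(z, z + t)` in `[-L/2, L/2]` which contain no impurity. -/
def emptyWindows {N : ℕ} (L t : ℝ) (x : Fin N → ℝ) : Set ℝ :=
  {z | z ∈ Icc (-L / 2) (L / 2 - t) ∧ ∀ i, x i ∉ Ioo z (z + t)}

/-! ### Empty windows: volume, bounded differences and mean -/

section EmptyWindows

variable {N : ℕ} {L t : ℝ}

/-- An empty window lies inside the interval containing its left end. The windows are open, so both
of their ends may be nodes. -/
lemma emptyWindows_eq_iUnion {x : Fin N → ℝ} (ht : 0 < t) (hg : ∀ j, 0 < gap L x j) :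
    emptyWindows L t x = ⋃ j, Icc (left L x j) (right L x j - t) := by
  ext z
  simp only [emptyWindows, mem_ofPred_eq, mem_iUnion, mem_Icc, mem_Ioo, not_and, not_lt]
  constructor
  · rintro ⟨⟨h1, h2⟩, h3⟩
    obtain ⟨j, hj1, hj2⟩ := exists_mem_Ico (x := x) h1 (by linarith : z < L / 2)
    refine ⟨j, hj1, ?_⟩
    rcases right_eq_point_or_half (L := L) (x := x) j with h | ⟨i, h⟩
    · linarith
    · have := h3 i (h ▸ hj2); linarith
  · rintro ⟨j, h1, h2⟩
    have := neg_half_le_left hg j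
    have := right_le_half hg j
    refine ⟨⟨by linarith, by linarith⟩, fun i hi => ?_⟩
    rcases point_notMem hg i j with h | h <;> linarith

/-- This turns a statistic of the ordered gaps into a volume which is symmetric in the impurities,
so that neither its mean nor its sensitivity to one point involves the ordering. -/
lemma volume_emptyWindows {x : Fin N → ℝ} (ht : 0 < t) (hg : ∀ j, 0 < gap L x j) :
    volume.real (emptyWindows L t x) = ∑ j, max (gap L x j - t) 0 := by
  rw [emptyWindows_eq_iUnion ht hg, measureReal_iUnion_fintype (h' := fun j => measure_Icc_lt_top.ne)]
  · refine Finset.sum_congr rfl fun j _ => ?_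
    rw [Real.volume_real_Icc, gap]; ring_nf
  · have : ∀ j k, j < k → Disjoint (Icc (left L x j) (right L x j - t))
        (Icc (left L x k) (right L x k - t)) := fun j k hjk => by
      rw [Set.disjoint_left]
      rintro z ⟨_, h1⟩ ⟨h2, _⟩
      have := right_le_left hg hjk
      linarith
    intro j k hjk
    rcases lt_or_gt_of_ne hjk with h | h
    · exact this j k h
    · exact (this k j h).symm
  · exact fun j => measurableSet_Icc

lemma volume_emptyWindows_ne_top (x : Fin N → ℝ) : volume (emptyWindows L t x) ≠ ⊤ :=
  ((measure_mono (fun _ hz => hz.1)).trans_lt (measure_Icc_lt_top (a := -L / 2)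
    (b := L / 2 - t))).ne

/-- Moving an impurity to `y` can only spoil windows containing `y`, and these start in an interval
of length `t`. -/
lemma volume_emptyWindows_update_le (ht : 0 < t) (x : Fin N → ℝ) (i : Fin N) (y : ℝ) :
    volume.real (emptyWindows L t x) ≤ volume.real (emptyWindows L t (Function.update x i y)) + t := by
  have hsub : emptyWindows L t x ⊆ emptyWindows L t (Function.update x i y) ∪ Icc (y - t) y := by
    rintro z ⟨h1, h2⟩
    by_cases hy : y ∈ Ioo z (z + t)
    · right; exact ⟨by linarith [hy.2], hy.1.le⟩
    · left
      refine ⟨h1, fun k => ?_⟩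
      by_cases hk : k = i
      · rw [hk, Function.update_self]; exact hy
      · rw [Function.update_of_ne hk]; exact h2 k
  have h1 := measureReal_mono (μ := volume) hsub
    (measure_union_ne_top (volume_emptyWindows_ne_top _) measure_Icc_lt_top.ne)
  refine h1.trans ((measureReal_union_le _ _).trans ?_)
  rw [Real.volume_real_Icc_of_le (by linarith)]
  linarith

lemma abs_volume_emptyWindows_update_sub_le (ht : 0 < t) (x : Fin N → ℝ) (i : Fin N) (y : ℝ) :
    |volume.real (emptyWindows L t (Function.update x i y)) - volume.real (emptyWindows L t x)|
      ≤ t := by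
  have h1 := volume_emptyWindows_update_le (L := L) ht x i y
  have h2 := volume_emptyWindows_update_le (L := L) ht (Function.update x i y) i (x i)
  rw [Function.update_idem, Function.update_eq_self] at h2
  rw [abs_le]; constructor <;> linarith

lemma abs_volume_emptyWindows_le (x : Fin N → ℝ) :
    |volume.real (emptyWindows L t x)| ≤ volume.real (Icc (-L / 2) (L / 2 - t)) := by
  rw [abs_of_nonneg measureReal_nonneg]
  exact measureReal_mono (fun _ hz => hz.1) measure_Icc_lt_top.ne

lemma measurableSet_emptyWindows_prod :
    MeasurableSet {p : (Fin N → ℝ) × ℝ | p.2 ∈ emptyWindows L t p.1} := by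
  have : {p : (Fin N → ℝ) × ℝ | p.2 ∈ emptyWindows L t p.1} =
      ({p | -L / 2 ≤ p.2} ∩ {p | p.2 ≤ L / 2 - t}) ∩
        ⋂ i, ({p | p.1 i ≤ p.2} ∪ {p | p.2 + t ≤ p.1 i}) := by
    ext p
    simp [emptyWindows, not_and_or, -not_and]
  rw [this]
  refine MeasurableSet.inter (MeasurableSet.inter ?_ ?_)
    (MeasurableSet.iInter fun i => MeasurableSet.union ?_ ?_) <;>
  exact measurableSet_le (by fun_prop) (by fun_prop)

lemma measurable_volume_emptyWindows :
    Measurable (fun x : Fin N → ℝ => volume.real (emptyWindows L t x)) :=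
  (measurable_measure_prodMk_left (ν := (volume : Measure ℝ))
    (measurableSet_emptyWindows_prod (N := N) (L := L) (t := t))).ennreal_toReal

/-- The expected length of the set of empty windows. -/
lemma integral_volume_emptyWindows (ht : 0 < t) (htL : t ≤ L) :
    ∫ x : Fin N → ℝ, volume.real (emptyWindows L t x)
        ∂(Measure.pi fun _ => ProbabilityTheory.cond volume (Icc (-L / 2) (L / 2))) =
      (L - t) * (1 - t / L) ^ N := by
  have hL : 0 < L := ht.trans_le htL
  set ν : Measure ℝ := ProbabilityTheory.cond volume (Icc (-L / 2) (L / 2)) with hν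
  have hvol : volume (Icc (-L / 2) (L / 2)) = ENNReal.ofReal L := by
    rw [Real.volume_Icc]; ring_nf
  have : IsProbabilityMeasure ν := by
    refine ProbabilityTheory.cond_isProbabilityMeasure_of_finite ?_ ?_ <;> rw [hvol]
    · simpa using hL
    · simp
  set π' : Measure (Fin N → ℝ) := Measure.pi fun _ => ν
  have hwin : ∀ z ∈ Icc (-L / 2) (L / 2 - t),
      ν (Ioo z (z + t))ᶜ = ENNReal.ofReal (1 - t / L) := by
    intro z hz
    have : ν (Ioo z (z + t)) = ENNReal.ofReal (t / L) := by
      rw [hν, ProbabilityTheory.cond_apply measurableSet_Icc, inter_eq_right.2, hvol,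
        Real.volume_Ioo, ← ENNReal.ofReal_inv_of_pos hL, ← ENNReal.ofReal_mul (by positivity)]
      · congr 1; field_simp; ring
      · intro w hw
        exact ⟨hz.1.trans hw.1.le, by linarith [hz.2, hw.2]⟩
    rw [prob_compl_eq_one_sub measurableSet_Ioo, this, ← ENNReal.ofReal_one,
      ← ENNReal.ofReal_sub _ (by positivity)]
  have hT := measurableSet_emptyWindows_prod (N := N) (L := L) (t := t)
  -- Tonelli on the set of pairs (configuration, empty window): for fixed `z` the event is that all
  -- `N` independent points avoid a set of probability `t / L`.
  have hleft := Measure.prod_apply (μ := π') (ν := (volume : Measure ℝ)) hT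
  have hright := Measure.prod_apply_symm (μ := π') (ν := (volume : Measure ℝ)) hT
  have hsec : ∀ z, π' ((fun x => (x, z)) ⁻¹' {p : (Fin N → ℝ) × ℝ | p.2 ∈ emptyWindows L t p.1}) =
      (Icc (-L / 2) (L / 2 - t)).indicator (fun _ => ENNReal.ofReal ((1 - t / L) ^ N)) z := by
    intro z
    by_cases hz : z ∈ Icc (-L / 2) (L / 2 - t)
    · have : (fun x => (x, z)) ⁻¹' {p : (Fin N → ℝ) × ℝ | p.2 ∈ emptyWindows L t p.1} =
          Set.pi univ fun _ => (Ioo z (z + t))ᶜ := by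
        ext x
        simp only [mem_preimage, mem_ofPred_eq, emptyWindows, Set.mem_pi, mem_compl_iff, mem_univ,
          forall_true_left]
        exact and_iff_right hz
      rw [this, Measure.pi_pi, indicator_of_mem hz]
      simp only [hwin z hz, Finset.prod_const, Finset.card_univ, Fintype.card_fin]
      rw [ENNReal.ofReal_pow (sub_nonneg.2 ((div_le_one hL).2 htL))]
    · have : (fun x => (x, z)) ⁻¹' {p : (Fin N → ℝ) × ℝ | p.2 ∈ emptyWindows L t p.1} = ∅ := by
        ext x
        simp only [mem_preimage, mem_ofPred_eq, emptyWindows, mem_empty_iff_false, iff_false]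
        exact fun h => hz h.1
      rw [this, measure_empty, indicator_of_notMem hz]
  rw [lintegral_congr hsec, lintegral_indicator measurableSet_Icc, setLIntegral_const,
    Real.volume_Icc, hleft] at hright
  rw [integral_eq_lintegral_of_nonneg_ae (Eventually.of_forall fun _ => measureReal_nonneg)
    measurable_volume_emptyWindows.aestronglyMeasurable]
  have : ∀ x : Fin N → ℝ, ENNReal.ofReal (volume.real (emptyWindows L t x)) =
      volume (Prod.mk x ⁻¹' {p : (Fin N → ℝ) × ℝ | p.2 ∈ emptyWindows L t p.1}) := fun x => by
    rw [ofReal_measureReal (volume_emptyWindows_ne_top x)]; rfl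
  rw [lintegral_congr this, hright, ENNReal.toReal_mul, ENNReal.toReal_ofReal, ENNReal.toReal_ofReal]
  · ring
  · linarith
  · exact pow_nonneg (sub_nonneg.2 ((div_le_one hL).2 htL)) _

end EmptyWindows

/-! ### Almost sure convergence of the density of empty windows -/

lemma tendsto_volume_atTop {lam : ℝ} (hlam : 0 < lam) {L : ℕ → ℝ} (hL : ∀ N, 0 < L N)
    (hLlam : Tendsto (fun N : ℕ => ((N : ℝ) + 1) / L N) atTop (𝓝 lam)) :
    (∀ᶠ N : ℕ in atTop, (N + 1 : ℝ) / (2 * lam) ≤ L N) ∧ Tendsto L atTop atTop := by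
  have h1 : ∀ᶠ N : ℕ in atTop, (N + 1 : ℝ) / (2 * lam) ≤ L N := by
    filter_upwards [hLlam.eventually_le_const (by linarith : lam < 2 * lam)] with N hN
    rw [div_le_iff₀ (hL N)] at hN
    rw [div_le_iff₀ (by positivity)]
    linarith
  refine ⟨h1, tendsto_atTop_mono' _ h1 ?_⟩
  exact (tendsto_atTop_add_const_right _ _ tendsto_natCast_atTop_atTop).atTop_div_const
    (by positivity)

lemma tendsto_mean_emptyWindows {lam : ℝ} (hlam : 0 < lam) {L : ℕ → ℝ} (hL : ∀ N, 0 < L N)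
    (hLlam : Tendsto (fun N : ℕ => ((N : ℝ) + 1) / L N) atTop (𝓝 lam)) (t : ℝ) :
    Tendsto (fun N => 1 / L N * ((L N - t) * (1 - t / L N) ^ N)) atTop (𝓝 (exp (-(lam * t)))) := by
  have hLtop := (tendsto_volume_atTop hlam hL hLlam).2
  have hinv : Tendsto (fun N => (L N)⁻¹) atTop (𝓝 0) := tendsto_inv_atTop_zero.comp hLtop
  -- There are `N` points but `N + 1` intervals, hence `N / L = (N + 1) / L - 1 / L`.
  have h1 : Tendsto (fun N : ℕ => (N : ℝ) * (-(t / L N))) atTop (𝓝 (-(lam * t))) := by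
    have := ((hLlam.sub hinv).mul_const t).neg
    rw [sub_zero] at this
    refine this.congr fun N => ?_
    have := (hL N).ne'
    field_simp; ring
  have h2 := Real.tendsto_one_add_pow_exp_of_tendsto h1
  have h3 : Tendsto (fun N => 1 - t * (L N)⁻¹) atTop (𝓝 1) := by
    simpa using (hinv.const_mul t).const_sub 1
  have := h3.mul h2
  rw [one_mul] at this
  refine this.congr fun N => ?_
  have := (hL N).ne'
  rw [← sub_eq_add_neg, ← mul_assoc]
  congr 1
  field_simp

/-- The law of the impurity positions is a product of uniform distributions. -/
lemma map_eq_pi {Ω : Type*} [MeasurableSpace Ω] {P : Measure Ω} [IsProbabilityMeasure P]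
    {N : ℕ} {L : ℝ} {X : Fin N → Ω → ℝ} (hXmeas : ∀ i, Measurable (X i))
    (hXunif : ∀ i, pdf.IsUniform (X i) (Icc (-L / 2) (L / 2)) P volume) (hXindep : iIndepFun X P) :
    P.map (fun ω i => X i ω) =
      Measure.pi fun _ => ProbabilityTheory.cond volume (Icc (-L / 2) (L / 2)) := by
  rw [(iIndepFun_iff_map_fun_eq_pi_map fun i => (hXmeas i).aemeasurable).1 hXindep]
  congr 1
  funext i
  exact hXunif i

lemma isProbabilityMeasure_cond_box {L : ℝ} (hL : 0 < L) :
    IsProbabilityMeasure (ProbabilityTheory.cond volume (Icc (-L / 2) (L / 2))) := by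
  have hvol : volume (Icc (-L / 2) (L / 2)) = ENNReal.ofReal L := by
    rw [Real.volume_Icc]; ring_nf
  refine ProbabilityTheory.cond_isProbabilityMeasure_of_finite ?_ ?_ <;> rw [hvol]
  · simpa using hL
  · simp

section Probability

variable {Ω : Type*} [MeasurableSpace Ω] {P : Measure Ω} [IsProbabilityMeasure P]
  {lam : ℝ} {L : ℕ → ℝ} {X : (N : ℕ) → Fin N → Ω → ℝ}

/-- With `N` differences of size `t`, a deviation `η * L` costs `exp (-η² L² / (2 N t²))`, which is
exponentially small in `N`. Borel–Cantelli then applies whatever the coupling between different `N`.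
-/
lemma ae_tendsto_emptyWindows (hlam : 0 < lam) (hL : ∀ N, 0 < L N)
    (hLlam : Tendsto (fun N : ℕ => ((N : ℝ) + 1) / L N) atTop (𝓝 lam))
    (hXmeas : ∀ N i, Measurable (X N i))
    (hXunif : ∀ N i, pdf.IsUniform (X N i) (Icc (-L N / 2) (L N / 2)) P volume)
    (hXindep : ∀ N, iIndepFun (X N) P) {t : ℝ} (ht : 0 < t) :
    ∀ᵐ ω ∂P, Tendsto (fun N => 1 / L N * volume.real (emptyWindows (L N) t (fun i => X N i ω)))
      atTop (𝓝 (exp (-(lam * t)))) := by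
  set m : ℕ → ℝ := fun N => (L N - t) * (1 - t / L N) ^ N
  obtain ⟨hLlow, hLtop⟩ := tendsto_volume_atTop hlam hL hLlam
  have key : ∀ η : ℝ, 0 < η → ∀ᵐ ω ∂P, ∀ᶠ N in atTop,
      |volume.real (emptyWindows (L N) t (fun i => X N i ω)) - m N| < η * L N := by
    intro η hη
    -- Inserting `L ≥ (N + 1) / (2λ)` into `η² L² / (2 N t²)` leaves at least `κ * N`.
    set κ : ℝ := η ^ 2 / (8 * lam ^ 2 * t ^ 2) with hκ
    have hκpos : 0 < κ := by positivity
    set A : ℕ → Set Ω := fun N =>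
      {ω | η * L N ≤ |volume.real (emptyWindows (L N) t (fun i => X N i ω)) - m N|}
    have hbound : ∀ᶠ N in atTop, P.real (A N) ≤ 2 * exp (-(κ * N)) := by
      filter_upwards [hLlow, hLtop.eventually_ge_atTop t, eventually_gt_atTop 0] with N hN htL hN0
      have := isProbabilityMeasure_cond_box (hL N)
      have hconc := measure_abs_sub_ge_le_of_bounded_differences
        (ProbabilityTheory.cond volume (Icc (-L N / 2) (L N / 2))) ⟨t, ht.le⟩ N
        (fun x => volume.real (emptyWindows (L N) t x)) measurable_volume_emptyWindows
        ⟨_, abs_volume_emptyWindows_le⟩ (abs_volume_emptyWindows_update_sub_le ht)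
        (η := η * L N) (mul_pos hη (hL N)).le
      rw [integral_volume_emptyWindows ht htL, ← map_eq_pi (hXmeas N) (hXunif N) (hXindep N),
        map_measureReal_apply (by fun_prop)
          (measurableSet_le measurable_const
            ((measurable_volume_emptyWindows.sub_const _).abs))] at hconc
      refine hconc.trans ?_
      have hN0' : (0 : ℝ) < N := by exact_mod_cast hN0
      have hsq : ((N + 1 : ℝ) / (2 * lam)) ^ 2 ≤ L N ^ 2 := by gcongr
      gcongr
      change -(η * L N) ^ 2 / (2 * (N * t ^ 2)) ≤ _
      rw [neg_div, neg_le_neg_iff, le_div_iff₀ (by positivity), hκ]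
      calc η ^ 2 / (8 * lam ^ 2 * t ^ 2) * N * (2 * (N * t ^ 2))
          = η ^ 2 * ((N : ℝ) / (2 * lam)) ^ 2 := by field_simp; ring
        _ ≤ η ^ 2 * ((N + 1 : ℝ) / (2 * lam)) ^ 2 := by gcongr; linarith
        _ ≤ _ := by rw [mul_pow]; gcongr
    have hsum : Summable (fun N => P.real (A N)) := by
      have hs : Summable (fun N : ℕ => 2 * exp (-(κ * N))) := by
        refine Summable.mul_left 2 ?_
        have := Real.summable_exp_nat_mul_iff.2 (neg_lt_zero.2 hκpos)
        refine this.congr fun N => ?_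
        ring_nf
      refine summable_of_isBigO_nat hs (Asymptotics.IsBigO.of_bound 1 ?_)
      filter_upwards [hbound] with N hN
      rw [norm_of_nonneg measureReal_nonneg, norm_of_nonneg (by positivity), one_mul]
      exact hN
    have hne : ∑' N, P (A N) ≠ ⊤ := by
      have : ∀ N, P (A N) = ENNReal.ofReal (P.real (A N)) := fun N =>
        (ofReal_measureReal).symm
      simp_rw [this]
      exact hsum.tsum_ofReal_ne_top
    filter_upwards [ae_eventually_notMem hne] with ω hω
    filter_upwards [hω] with N hN
    exact not_le.1 hN
  have key' : ∀ᵐ ω ∂P, ∀ k : ℕ, ∀ᶠ N in atTop,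
      |volume.real (emptyWindows (L N) t (fun i => X N i ω)) - m N| < 1 / ((k : ℝ) + 1) * L N :=
    ae_all_iff.2 fun k => key _ (by positivity)
  filter_upwards [key'] with ω hω
  have hm := tendsto_mean_emptyWindows hlam hL hLlam t
  have hdiff : Tendsto (fun N => 1 / L N * volume.real (emptyWindows (L N) t (fun i => X N i ω)) -
      1 / L N * m N) atTop (𝓝 0) := by
    rw [Metric.tendsto_atTop']
    intro η hη
    obtain ⟨k, hk⟩ := exists_nat_one_div_lt hη
    obtain ⟨n, hn⟩ := eventually_atTop.1 (hω k)
    refine ⟨n, fun N hN => ?_⟩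
    have h1 := hn N hN.le
    have hLN := hL N
    rw [dist_zero_right, ← mul_sub, norm_mul, Real.norm_eq_abs, Real.norm_eq_abs,
      abs_of_pos (by positivity), one_div_mul_eq_div, div_lt_iff₀ hLN]
    exact h1.trans (mul_lt_mul_of_pos_right hk hLN)
  have := hdiff.add hm
  rw [zero_add] at this
  exact this.congr fun N => sub_add_cancel _ _

lemma ae_gap_pos (hL : ∀ N, 0 < L N) (hXmeas : ∀ N i, Measurable (X N i))
    (hXunif : ∀ N i, pdf.IsUniform (X N i) (Icc (-L N / 2) (L N / 2)) P volume)
    (hXindep : ∀ N, iIndepFun (X N) P) :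
    ∀ᵐ ω ∂P, ∀ N j, 0 < gap (L N) (fun i => X N i ω) j := by
  rw [ae_all_iff]
  intro N
  have hac : ∀ i, P.map (X N i) ≪ volume := fun i => by
    rw [hXunif N i]; exact ProbabilityTheory.cond_absolutelyContinuous
  have hbox : ∀ i, ∀ᵐ ω ∂P, X N i ω ∈ Ioo (-L N / 2) (L N / 2) := by
    intro i
    have h1 : ∀ᵐ y ∂(P.map (X N i)), y ∈ Icc (-L N / 2) (L N / 2) := by
      rw [hXunif N i]
      exact ae_cond_mem measurableSet_Icc
    have h2 : ∀ᵐ y ∂(P.map (X N i)), y ∉ ({-L N / 2, L N / 2} : Set ℝ) :=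
      (hac i).ae_le (measure_eq_zero_iff_ae_notMem.1 ((Set.toFinite _).measure_zero volume))
    filter_upwards [ae_of_ae_map (hXmeas N i).aemeasurable h1,
      ae_of_ae_map (hXmeas N i).aemeasurable h2] with ω ha hb
    simp only [mem_insert_iff, mem_singleton_iff, not_or] at hb
    exact ⟨lt_of_le_of_ne ha.1 (Ne.symm hb.1), lt_of_le_of_ne ha.2 hb.2⟩
  have hne : ∀ i k, i ≠ k → ∀ᵐ ω ∂P, X N i ω ≠ X N k ω := by
    intro i k hik
    have hind := (hXindep N).indepFun hik
    have hmap := (indepFun_iff_map_prod_eq_prod_map_map (hXmeas N i).aemeasurable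
      (hXmeas N k).aemeasurable).1 hind
    have := Measure.isProbabilityMeasure_map (μ := P) (hXmeas N i).aemeasurable
    have := Measure.isProbabilityMeasure_map (μ := P) (hXmeas N k).aemeasurable
    -- By independence the joint law is a product of laws without atoms, which does not charge the
    -- diagonal.
    have hd : ∀ᵐ p ∂((P.map (X N i)).prod (P.map (X N k))), p ∉ {p : ℝ × ℝ | p.1 = p.2} := by
      rw [← measure_eq_zero_iff_ae_notMem,
        Measure.measure_prod_null (measurableSet_eq_fun measurable_fst measurable_snd)]
      refine Eventually.of_forall fun y => hac k ?_
      refine measure_mono_null (t := {y}) (fun z hz => ?_) (by simp)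
      exact (show y = z from hz).symm
    rw [← hmap] at hd
    filter_upwards [ae_of_ae_map ((hXmeas N i).prodMk (hXmeas N k)).aemeasurable hd] with ω h
    exact h
  filter_upwards [ae_all_iff.2 hbox, ae_all_iff.2 fun i => ae_all_iff.2 fun k =>
    ae_all_iff.2 (hne i k)] with ω h1 h2 j
  refine gap_pos_of_injective (hL N) (fun i k hik => ?_) h1 j
  by_contra h
  exact h2 i k h hik

end Probability

/-! ### Weak convergence of the size-biased law of the gaps -/

/-- Weak convergence tested against bounded, almost everywhere continuous functions. -/
lemma tendsto_integral_of_ae_continuousAt {ι : Type*} {F : Filter ι} [F.IsCountablyGenerated]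
    {μs : ι → ProbabilityMeasure ℝ} {μ : ProbabilityMeasure ℝ} (h : Tendsto μs F (𝓝 μ))
    {f : ℝ → ℝ} (hf : Measurable f) {C : ℝ} (hC : ∀ x, |f x| ≤ C)
    (hcont : ∀ᵐ x ∂(μ : Measure ℝ), ContinuousAt f x) :
    Tendsto (fun i => ∫ x, f x ∂(μs i : Measure ℝ)) F (𝓝 (∫ x, f x ∂(μ : Measure ℝ))) := by
  have hmap : Tendsto (fun i => (μs i).map hf.aemeasurable) F (𝓝 (μ.map hf.aemeasurable)) := by
    refine tendsto_of_forall_isClosed_limsup_le' fun S hS => ?_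
    have h1 : ∀ ν : ProbabilityMeasure ℝ,
        ((ν.map hf.aemeasurable : ProbabilityMeasure ℝ) : Measure ℝ) S = ν (f ⁻¹' S) := fun ν => by
      rw [ProbabilityMeasure.toMeasure_map, Measure.map_apply hf hS.measurableSet,
        ProbabilityMeasure.ennreal_coeFn_eq_coeFn_toMeasure]
    simp only [h1, ProbabilityMeasure.ennreal_coeFn_eq_coeFn_toMeasure]
    -- The mapping theorem via portmanteau: a continuity point of `f` in the closure of `f ⁻¹' S`
    -- already lies in `f ⁻¹' S`, since `S` is closed.
    have h2 : (μ : Measure ℝ) (closure (f ⁻¹' S)) ≤ (μ : Measure ℝ) (f ⁻¹' S) := by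
      refine measure_mono_ae ?_
      filter_upwards [hcont] with x hx hxS
      exact hS.closure_eq ▸ (hx.continuousWithinAt.mem_closure hxS (mapsTo_preimage f S))
    refine le_trans ?_ h2
    refine le_trans (limsup_le_limsup (Eventually.of_forall fun i => ?_))
      (ProbabilityMeasure.limsup_measure_closed_le_of_tendsto h isClosed_closure)
    exact measure_mono subset_closure
  -- The identity truncated to `[-C, C]`: bounded and continuous, and without effect on the values
  -- of `f`.
  set φ : BoundedContinuousFunction ℝ ℝ := BoundedContinuousFunction.ofNormedAddCommGroup
    (fun y => max (-C) (min y C)) (by fun_prop) (|C|) (fun y => by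
      rw [Real.norm_eq_abs, abs_le]
      constructor
      · exact (neg_le_neg (le_abs_self C)).trans (le_max_left _ _)
      · refine max_le (neg_le_abs C) ((min_le_right _ _).trans (le_abs_self C))) with hφ
  have hφf : ∀ x, φ (f x) = f x := fun x => by
    have := abs_le.1 (hC x)
    change max (-C) (min (f x) C) = f x
    rw [min_eq_left this.2, max_eq_right this.1]
  have := ProbabilityMeasure.tendsto_iff_forall_integral_tendsto.1 hmap φ
  have e : ∀ ν : ProbabilityMeasure ℝ,
      ∫ y, φ y ∂((ν.map hf.aemeasurable : ProbabilityMeasure ℝ) : Measure ℝ) =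
        ∫ x, f x ∂(ν : Measure ℝ) := fun ν => by
    rw [ProbabilityMeasure.toMeasure_map,
      integral_map hf.aemeasurable φ.continuous.aestronglyMeasurable]
    simp only [hφf]
  simpa only [e] using this

/-- The size-biased empirical measure of the numbers `g j`. -/
def sizeBiased {n : ℕ} (L : ℝ) (g : Fin n → ℝ) : Measure ℝ :=
  ∑ j, ENNReal.ofReal (g j / L) • Measure.dirac (g j)

lemma integral_sizeBiased {n : ℕ} {L : ℝ} (hL : 0 < L) {g : Fin n → ℝ} (hg : ∀ j, 0 < g j)
    (f : ℝ → ℝ) : ∫ x, f x ∂(sizeBiased L g) = 1 / L * ∑ j, g j * f (g j) := by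
  unfold sizeBiased
  rw [integral_finsetSum_measure]
  · rw [Finset.mul_sum]
    refine Finset.sum_congr rfl fun j _ => ?_
    rw [integral_smul_measure, integral_dirac, ENNReal.toReal_ofReal (div_pos (hg j) hL).le,
      smul_eq_mul]
    ring
  · intro j _
    exact (integrable_dirac (by simp)).smul_measure ENNReal.ofReal_ne_top

lemma isProbabilityMeasure_sizeBiased {n : ℕ} {L : ℝ} (hL : 0 < L) {g : Fin n → ℝ}
    (hg : ∀ j, 0 < g j) (hsum : ∑ j, g j = L) : IsProbabilityMeasure (sizeBiased L g) := by
  constructor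
  unfold sizeBiased
  rw [Measure.finsetSum_apply]
  simp only [Measure.smul_apply, measure_univ, smul_eq_mul, mul_one]
  rw [← ENNReal.ofReal_sum_of_nonneg fun j _ => (div_pos (hg j) hL).le, ← Finset.sum_div, hsum,
    div_self hL.ne', ENNReal.ofReal_one]

/-- The limit of the size-biased laws of the gaps. -/
def limSizeBiased (lam : ℝ) : Measure ℝ :=
  (volume.restrict (Ioi 0)).withDensity fun ℓ => ENNReal.ofReal (lam ^ 2 * ℓ * exp (-lam * ℓ))

lemma integral_limSizeBiased (lam : ℝ) (f : ℝ → ℝ) :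
    ∫ x, f x ∂(limSizeBiased lam) = lam ^ 2 * ∫ ℓ in Ioi (0 : ℝ), exp (-lam * ℓ) * (ℓ * f ℓ) := by
  unfold limSizeBiased
  rw [integral_withDensity_eq_integral_toReal_smul (by fun_prop) (by simp), ← integral_const_mul]
  refine setIntegral_congr_fun measurableSet_Ioi fun ℓ hℓ => ?_
  have hℓ : (0 : ℝ) < ℓ := hℓ
  simp only [smul_eq_mul]
  rw [ENNReal.toReal_ofReal (by positivity)]
  ring

lemma limSizeBiased_Ioi {lam : ℝ} (hlam : 0 < lam) {t : ℝ} (ht : 0 ≤ t) :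
    limSizeBiased lam (Ioi t) = ENNReal.ofReal ((1 + lam * t) * exp (-lam * t)) := by
  unfold limSizeBiased
  rw [withDensity_apply _ measurableSet_Ioi, Measure.restrict_restrict measurableSet_Ioi,
    inter_eq_left.2 (Ioi_subset_Ioi ht)]
  set G : ℝ → ℝ := fun x => -((1 + lam * x) * exp (-lam * x)) with hG
  have hd : ∀ x ∈ Ici t, HasDerivAt G (lam ^ 2 * x * exp (-lam * x)) x := by
    intro x _
    have h1 : HasDerivAt (fun x => 1 + lam * x) lam x := by
      simpa using ((hasDerivAt_id x).const_mul lam).const_add 1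
    have h2 : HasDerivAt (fun x => exp (-lam * x)) (exp (-lam * x) * -lam) x := by
      simpa using ((hasDerivAt_id x).const_mul (-lam)).exp
    refine (h1.mul h2).neg.congr_deriv ?_
    ring
  have hnn : ∀ x ∈ Ioi t, 0 ≤ lam ^ 2 * x * exp (-lam * x) := fun x hx => by
    have : 0 < x := ht.trans_lt hx
    positivity
  have hlim : Tendsto G atTop (𝓝 0) := by
    have hlin : Tendsto (fun x => lam * x) atTop atTop := tendsto_id.const_mul_atTop hlam
    have h1 := (tendsto_pow_mul_exp_neg_atTop_nhds_zero 1).comp hlin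
    have h0 := (tendsto_pow_mul_exp_neg_atTop_nhds_zero 0).comp hlin
    have := (h0.add h1).neg
    simp only [add_zero, neg_zero] at this
    refine this.congr fun x => ?_
    simp only [Function.comp, hG]
    ring_nf
  rw [← ofReal_integral_eq_lintegral_ofReal (integrableOn_Ioi_deriv_of_nonneg' hd hnn hlim)
    ((ae_restrict_iff' measurableSet_Ioi).2 (Eventually.of_forall hnn)),
    integral_Ioi_of_hasDerivAt_of_nonneg' hd hnn hlim]
  congr 1
  simp [hG]

lemma limSizeBiased_Iic (lam : ℝ) : limSizeBiased lam (Iic 0) = 0 := by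
  unfold limSizeBiased
  rw [withDensity_apply _ measurableSet_Iic, Measure.restrict_restrict measurableSet_Iic,
    (Iic_disjoint_Ioi le_rfl).inter_eq, Measure.restrict_empty, lintegral_zero_measure]

lemma isProbabilityMeasure_limSizeBiased {lam : ℝ} (hlam : 0 < lam) :
    IsProbabilityMeasure (limSizeBiased lam) := by
  constructor
  rw [← Iic_union_Ioi (a := (0 : ℝ)), measure_union (Iic_disjoint_Ioi le_rfl) measurableSet_Ioi,
    limSizeBiased_Iic, limSizeBiased_Ioi hlam le_rfl]
  simp

lemma ae_limSizeBiased {lam : ℝ} {p : ℝ → Prop}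
    (h : ∀ᵐ x ∂(volume.restrict (Ioi (0 : ℝ))), p x) : ∀ᵐ x ∂(limSizeBiased lam), p x :=
  (withDensity_absolutelyContinuous _ _).ae_le h

/-- The tail of the size-biased law, compared with the functions `max (g - t) 0`. -/
lemma mul_indicator_Ioi_le {t h g : ℝ} (ht : 0 ≤ t) (hh : 0 < h) :
    g * (Ioi t).indicator 1 g ≤ max (g - t) 0 + t / h * (max (g - (t - h)) 0 - max (g - t) 0) := by
  by_cases hgt : t < g
  · rw [indicator_of_mem (show g ∈ Ioi t from hgt), max_eq_left (by linarith),
      max_eq_left (by linarith)]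
    have : t / h * (g - (t - h) - (g - t)) = t := by field_simp; ring
    rw [this, Pi.one_apply]; linarith
  · rw [indicator_of_notMem (show g ∉ Ioi t from hgt), max_eq_right (by linarith : g - t ≤ 0),
      mul_zero, sub_zero, zero_add]
    exact mul_nonneg (div_nonneg ht hh.le) (le_max_right _ _)

lemma le_mul_indicator_Ioi {t h g : ℝ} (ht : 0 ≤ t) (hh : 0 < h) :
    max (g - t) 0 + t / h * (max (g - t) 0 - max (g - (t + h)) 0) ≤ g * (Ioi t).indicator 1 g := by
  by_cases hgt : t < g
  · rw [indicator_of_mem (show g ∈ Ioi t from hgt), max_eq_left (by linarith : 0 ≤ g - t)]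
    have h1 := le_max_left (g - (t + h)) 0
    have h2 : t / h * (g - t - max (g - (t + h)) 0) ≤ t / h * h := by
      gcongr; linarith
    rw [div_mul_cancel₀ _ hh.ne'] at h2
    rw [Pi.one_apply]; linarith
  · rw [indicator_of_notMem (show g ∉ Ioi t from hgt), max_eq_right (by linarith : g - t ≤ 0),
      max_eq_right (by linarith)]
    simp

lemma exists_rat_pos_of_eventually {p : ℝ → Prop} (h : ∀ᶠ x in 𝓝 (0 : ℝ), p x) {b : ℝ}
    (hb : 0 < b) : ∃ q : ℚ, (0 : ℝ) < q ∧ (q : ℝ) < b ∧ p q := by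
  obtain ⟨r, hr, hball⟩ := Metric.eventually_nhds_iff.1 h
  obtain ⟨q, hq0, hq⟩ := exists_rat_btwn (lt_min hr hb)
  refine ⟨q, hq0, hq.trans_le (min_le_right _ _), hball ?_⟩
  rw [dist_zero_right, Real.norm_of_nonneg hq0.le]
  exact hq.trans_le (min_le_left _ _)

/-! ### From densities of empty windows to the law of large numbers for the gaps -/

section Gaps

variable {lam : ℝ} {L : ℕ → ℝ} {g : (N : ℕ) → Fin (N + 1) → ℝ}

/-- With `W(t) = e^{-λt}` the limit is `W(t) - t W'(t)`. Since `max (g - t) 0` is convex in `t`,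
difference quotients of step `h` bound the size-biased tail from both sides; first `N → ∞` with `h`
rational and fixed, then `h` is taken small. -/
lemma tendsto_tail (hlam : 0 < lam) (hL : ∀ N, 0 < L N)
    (hW : ∀ t : ℚ, 0 < t → Tendsto (fun N => 1 / L N * ∑ j, max (g N j - t) 0) atTop
      (𝓝 (exp (-(lam * t))))) (t : ℚ) (ht : 0 < t) :
    Tendsto (fun N => 1 / L N * ∑ j, g N j * (Ioi (t : ℝ)).indicator 1 (g N j)) atTop
      (𝓝 ((1 + lam * t) * exp (-lam * t))) := by
  have ht' : (0 : ℝ) < t := by exact_mod_cast ht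
  have hlin : ∀ (a b c : ℚ), 0 < a → 0 < b → 0 < c → ∀ r : ℝ,
      Tendsto (fun N => 1 / L N * ∑ j, (max (g N j - a) 0 + r * (max (g N j - b) 0 -
        max (g N j - c) 0))) atTop
        (𝓝 (exp (-(lam * a)) + r * (exp (-(lam * b)) - exp (-(lam * c))))) := by
    intro a b c ha hb hc r
    refine ((hW a ha).add (((hW b hb).sub (hW c hc)).const_mul r)).congr fun N => ?_
    rw [Finset.sum_add_distrib, ← Finset.mul_sum, Finset.sum_sub_distrib]
    ring
  rw [tendsto_order]
  constructor
  · intro y hy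
    have hcont : ContinuousAt (fun h : ℝ => exp (-lam * t) + lam * t * exp (-lam * (t + h))) 0 := by
      fun_prop
    have hev : ∀ᶠ h in 𝓝 (0 : ℝ), y < exp (-lam * t) + lam * t * exp (-lam * (t + h)) := by
      refine hcont.eventually_const_lt ?_
      simp only [add_zero]; linarith
    obtain ⟨h, hh0, -, hh⟩ := exists_rat_pos_of_eventually hev one_pos
    have hlim := hlin t t (t + h) ht ht (by exact_mod_cast add_pos ht' hh0) (t / h)
    push_cast at hlim
    have hval : y < exp (-(lam * t)) + t / h * (exp (-(lam * t)) - exp (-(lam * (t + h)))) := by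
      refine hh.trans_le ?_
      have e1 : exp (-(lam * t)) = exp (-lam * (t + h)) * exp (lam * h) := by
        rw [← exp_add]; ring_nf
      have e2 : exp (-(lam * (t + h))) = exp (-lam * (t + h)) := by ring_nf
      -- The inequality `1 + x ≤ e^x` bounds the difference quotient of the exponential by a
      -- function continuous at `h = 0`, so no derivative has to be taken.
      have e3 := add_one_le_exp (lam * h)
      have e4 : lam * t * exp (-lam * (t + h)) =
          t / h * (exp (-lam * (t + h)) * (lam * h)) := by field_simp
      rw [e2, e4, show -lam * (t : ℝ) = -(lam * t) by ring]
      gcongr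
      rw [e1]
      nlinarith [exp_pos (-lam * ((t : ℝ) + h))]
    filter_upwards [hlim.eventually_const_lt hval] with N hN
    refine hN.trans_le ?_
    have := hL N
    gcongr with j _
    exact le_mul_indicator_Ioi ht'.le hh0
  · intro y hy
    have hcont : ContinuousAt (fun h : ℝ => exp (-lam * t) + lam * t * exp (-lam * (t - h))) 0 := by
      fun_prop
    have hev : ∀ᶠ h in 𝓝 (0 : ℝ), exp (-lam * t) + lam * t * exp (-lam * (t - h)) < y := by
      refine hcont.eventually_lt_const ?_
      simp only [sub_zero]; linarith
    obtain ⟨h, hh0, hht, hh⟩ := exists_rat_pos_of_eventually hev ht'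
    have hlim := hlin t (t - h) t ht (by exact_mod_cast sub_pos.2 hht) ht (t / h)
    push_cast at hlim
    have hval : exp (-(lam * t)) + t / h * (exp (-(lam * (t - h))) - exp (-(lam * t))) < y := by
      refine lt_of_le_of_lt ?_ hh
      have e1 : exp (-(lam * t)) = exp (-lam * (t - h)) * exp (-(lam * h)) := by
        rw [← exp_add]; ring_nf
      have e2 : exp (-(lam * (t - h))) = exp (-lam * (t - h)) := by ring_nf
      have e3 := add_one_le_exp (-(lam * h))
      have e4 : lam * t * exp (-lam * (t - h)) =
          t / h * (exp (-lam * (t - h)) * (lam * h)) := by field_simp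
      rw [e2, e4, show -lam * (t : ℝ) = -(lam * t) by ring]
      gcongr
      rw [e1]
      nlinarith [exp_pos (-lam * ((t : ℝ) - h))]
    filter_upwards [hlim.eventually_lt_const hval] with N hN
    refine lt_of_le_of_lt ?_ hN
    have := hL N
    gcongr with j _
    exact mul_indicator_Ioi_le ht'.le hh0

/-- Half-open intervals with rational end-points form a π-system containing small neighbourhoods of
every point, so convergence of their masses suffices; rational tails determine these masses. For `q
≤ 0` the tail is the total mass, which is `1` because the gaps sum to `L`. -/
lemma tendsto_sizeBiased (hlam : 0 < lam) (hL : ∀ N, 0 < L N) (hg : ∀ N j, 0 < g N j)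
    (hsum : ∀ N, ∑ j, g N j = L N)
    (hW : ∀ t : ℚ, 0 < t → Tendsto (fun N => 1 / L N * ∑ j, max (g N j - t) 0) atTop
      (𝓝 (exp (-(lam * t))))) :
    Tendsto (β := ProbabilityMeasure ℝ)
      (fun N => ⟨sizeBiased (L N) (g N), isProbabilityMeasure_sizeBiased (hL N) (hg N) (hsum N)⟩)
      atTop (𝓝 ⟨limSizeBiased lam, isProbabilityMeasure_limSizeBiased hlam⟩) := by
  have := isProbabilityMeasure_limSizeBiased hlam
  have hp := fun N => isProbabilityMeasure_sizeBiased (hL N) (hg N) (hsum N)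
  have htail : ∀ q : ℚ, Tendsto (fun N => (sizeBiased (L N) (g N)).real (Ioi (q : ℝ))) atTop
      (𝓝 ((limSizeBiased lam).real (Ioi (q : ℝ)))) := by
    intro q
    have e : ∀ N, (sizeBiased (L N) (g N)).real (Ioi (q : ℝ)) =
        1 / L N * ∑ j, g N j * (Ioi (q : ℝ)).indicator 1 (g N j) := fun N => by
      rw [← integral_indicator_one measurableSet_Ioi, integral_sizeBiased (hL N) (hg N)]
    simp_rw [e]
    rcases lt_or_ge 0 q with hq | hq
    · have hq' : (0 : ℝ) ≤ q := by exact_mod_cast hq.le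
      rw [measureReal_def, limSizeBiased_Ioi hlam hq', ENNReal.toReal_ofReal (by positivity)]
      exact tendsto_tail hlam hL hW q hq
    · have hq' : (q : ℝ) ≤ 0 := by exact_mod_cast hq
      have h1 : (limSizeBiased lam).real (Ioi (q : ℝ)) = 1 := by
        have h2 := measureReal_mono (μ := limSizeBiased lam) (Ioi_subset_Ioi hq')
        have h3 : (limSizeBiased lam).real (Ioi 0) = 1 := by
          rw [measureReal_def, limSizeBiased_Ioi hlam le_rfl]; simp
        exact le_antisymm measureReal_le_one (h3 ▸ h2)
      rw [h1]
      refine tendsto_const_nhds.congr fun N => ?_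
      have : ∀ j, g N j * (Ioi (q : ℝ)).indicator 1 (g N j) = g N j := fun j => by
        rw [indicator_of_mem (show g N j ∈ Ioi (q : ℝ) from hq'.trans_lt (hg N j)), Pi.one_apply,
          mul_one]
      simp_rw [this]
      rw [hsum, one_div_mul_cancel (hL N).ne']
  refine IsPiSystem.tendsto_probabilityMeasure_of_tendsto_of_mem
    (S := {s | ∃ a b : ℚ, s = Ioc (a : ℝ) b}) ?_ ?_ ?_ ?_
  · rintro _ ⟨a, b, rfl⟩ _ ⟨c, d, rfl⟩ _
    exact ⟨max a c, min b d, by rw [Ioc_inter_Ioc]; push_cast; rfl⟩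
  · rintro _ ⟨a, b, rfl⟩
    exact measurableSet_Ioc
  · intro u hu x hx
    obtain ⟨a, b, hab, hsub⟩ := mem_nhds_iff_exists_Ioo_subset.1 (hu.mem_nhds hx)
    obtain ⟨p, hp1, hp2⟩ := exists_rat_btwn hab.1
    obtain ⟨q, hq1, hq2⟩ := exists_rat_btwn hab.2
    exact ⟨_, ⟨p, q, rfl⟩, Ioc_mem_nhds hp2 hq1, fun z hz =>
      hsub ⟨hp1.trans hz.1, hz.2.trans_lt hq2⟩⟩
  · rintro _ ⟨a, b, rfl⟩
    rw [← NNReal.tendsto_coe]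
    change Tendsto (fun N => (sizeBiased (L N) (g N)).real (Ioc (a : ℝ) b)) atTop
      (𝓝 ((limSizeBiased lam).real (Ioc (a : ℝ) b)))
    rcases le_or_gt (a : ℝ) b with hab | hab
    · have : ∀ (m : Measure ℝ) [IsFiniteMeasure m],
          m.real (Ioc (a : ℝ) b) = m.real (Ioi (a : ℝ)) - m.real (Ioi (b : ℝ)) := by
        intro m _
        rw [← Ioc_union_Ioi_eq_Ioi hab, measureReal_union _ measurableSet_Ioi]
        · ring
        · rw [Set.disjoint_left]
          intro z hz hz'
          exact absurd hz.2 (not_le.2 hz')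
      simp_rw [this]
      exact (htail a).sub (htail b)
    · rw [Ioc_eq_empty (not_lt.2 hab.le)]
      simp

/-- The law of large numbers for the gaps. -/
lemma tendsto_sum_gaps (hlam : 0 < lam) (hL : ∀ N, 0 < L N) (hg : ∀ N j, 0 < g N j)
    (hsum : ∀ N, ∑ j, g N j = L N)
    (hW : ∀ t : ℚ, 0 < t → Tendsto (fun N => 1 / L N * ∑ j, max (g N j - t) 0) atTop
      (𝓝 (exp (-(lam * t)))))
    {F : ℝ → ℝ} (hF : Measurable F) {C : ℝ} (hC : ∀ ℓ, 0 < ℓ → |F ℓ| ≤ C * ℓ)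
    (hcont : ∀ᵐ ℓ ∂(volume.restrict (Ioi (0 : ℝ))), ContinuousAt F ℓ) :
    Tendsto (fun N => 1 / L N * ∑ j, F (g N j)) atTop
      (𝓝 (lam ^ 2 * ∫ ℓ in Ioi (0 : ℝ), exp (-lam * ℓ) * F ℓ)) := by
  have hC0 : 0 ≤ C := by
    have := hC 1 one_pos
    rw [mul_one] at this
    exact (abs_nonneg _).trans this
  -- Size biasing multiplies by `ℓ`, so `F ℓ / ℓ` is the function to test against; linear growth of
  -- `F` makes it bounded.
  set f : ℝ → ℝ := (Ioi (0 : ℝ)).indicator fun ℓ => F ℓ / ℓ with hf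
  have hfF : ∀ ℓ, 0 < ℓ → ℓ * f ℓ = F ℓ := fun ℓ hℓ => by
    rw [hf, indicator_of_mem (show ℓ ∈ Ioi (0 : ℝ) from hℓ)]; field_simp
  have hfm : Measurable f := (hF.div measurable_id).indicator measurableSet_Ioi
  have hfC : ∀ x, |f x| ≤ C := by
    intro x
    by_cases hx : 0 < x
    · rw [hf, indicator_of_mem (show x ∈ Ioi (0 : ℝ) from hx), abs_div, abs_of_pos hx,
        div_le_iff₀ hx]
      exact hC x hx
    · rw [hf, indicator_of_notMem (show x ∉ Ioi (0 : ℝ) from hx), abs_zero]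
      exact hC0
  have hfc : ∀ᵐ x ∂(limSizeBiased lam), ContinuousAt f x := by
    refine ae_limSizeBiased ?_
    filter_upwards [hcont, ae_restrict_mem measurableSet_Ioi] with x hx hx0
    have hx0 : (0 : ℝ) < x := hx0
    refine (hx.div continuousAt_id hx0.ne').congr ?_
    filter_upwards [Ioi_mem_nhds hx0] with y hy
    rw [hf, indicator_of_mem hy]; rfl
  have := tendsto_integral_of_ae_continuousAt (tendsto_sizeBiased hlam hL hg hsum hW) hfm hfC hfc
  simp only [ProbabilityMeasure.coe_mk] at this
  rw [integral_limSizeBiased] at this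
  have e : ∫ ℓ in Ioi (0 : ℝ), exp (-lam * ℓ) * (ℓ * f ℓ) =
      ∫ ℓ in Ioi (0 : ℝ), exp (-lam * ℓ) * F ℓ :=
    setIntegral_congr_fun measurableSet_Ioi fun ℓ hℓ => by simp only [hfF ℓ hℓ]
  rw [e] at this
  refine this.congr fun N => ?_
  rw [integral_sizeBiased (hL N) (hg N)]
  simp only [hfF _ (hg N _)]

end Gaps

/-! ### The limiting density of states -/

lemma energy_mul_rpow (s : ℕ) {E : ℝ} (hE : 0 < E) :
    energy (π / √2 * (s + 1) * E ^ (-(1 / 2) : ℝ)) (s + 1) = E := by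
  unfold energy
  have h2 : (E ^ (-(1 / 2) : ℝ)) ^ 2 = E⁻¹ := by
    rw [← rpow_natCast, ← rpow_mul hE.le]; norm_num [rpow_neg_one]
  rw [mul_pow, mul_pow, h2, div_pow, sq_sqrt (by norm_num : (0 : ℝ) ≤ 2)]
  push_cast
  field_simp

/-- The density of states superposes, over `s`, the images of `λ² e^{-λℓ} dℓ` under `ℓ ↦ E_s(ℓ)`.
Each Jacobian is proportional to `(s + 1) E^{-3/2}`, and `∑ (s + 1) r^{s+1} = r / (1 - r)²` with `r
= e^{-cλ/√E}`. -/
lemma hasSum_dos (lam β μ : ℝ) (hlam : 0 < lam) {E : ℝ} (hE : 0 < E) :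
    HasSum (fun s : ℕ => π / √2 * (s + 1) * (|(-(1 / 2) : ℝ)| * E ^ (-(1 / 2) - 1 : ℝ) *
      (lam ^ 2 * exp (-lam * (π / √2 * (s + 1) * E ^ (-(1 / 2) : ℝ))) * occ β μ E)))
      (dos lam E * occ β μ E) := by
  set c := π / √2 with hc
  have hcpos : 0 < c := by positivity
  set r := exp (-(c * lam / √E)) with hr
  have hr1 : r < 1 := exp_lt_one_iff.2 (neg_lt_zero.2 (by positivity))
  have hr0 : 0 < r := exp_pos _
  have hgeo := hasSum_coe_mul_geometric_of_norm_lt_one (𝕜 := ℝ) (r := r)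
    (by rw [norm_of_nonneg hr0.le]; exact hr1)
  have hgeo' : HasSum (fun s : ℕ => ((s : ℝ) + 1) * r ^ (s + 1)) (r / (1 - r) ^ 2) := by
    have := (hasSum_nat_add_iff 1).2 (by simpa using hgeo :
      HasSum (fun n : ℕ => (n : ℝ) * r ^ n) (r / (1 - r) ^ 2 + ∑ i ∈ Finset.range 1, (i : ℝ) * r ^ i))
    simpa using this
  have h32 : E ^ (-(1 / 2) - 1 : ℝ) = (E ^ (3 / 2 : ℝ))⁻¹ := by
    rw [← rpow_neg hE.le]; norm_num
  have h12 : E ^ (-(1 / 2) : ℝ) = (√E)⁻¹ := by rw [rpow_neg hE.le, sqrt_eq_rpow]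
  have hval : dos lam E * occ β μ E =
      lam ^ 2 * c / 2 * (E ^ (3 / 2 : ℝ))⁻¹ * occ β μ E * (r / (1 - r) ^ 2) := by
    unfold dos
    have hre : exp (c * lam / √E) = r⁻¹ := by rw [hr, ← exp_neg, neg_neg]
    rw [← hc, hre]
    have h1r : 1 - r ≠ 0 := by linarith
    have h3 : (0 : ℝ) < E ^ (3 / 2 : ℝ) := by positivity
    have h4 : r⁻¹ - 1 = (1 - r) / r := by field_simp
    rw [h4]
    field_simp
  rw [hval]
  refine (hgeo'.mul_left (lam ^ 2 * c / 2 * (E ^ (3 / 2 : ℝ))⁻¹ * occ β μ E)).congr_fun ?_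
  intro s
  have hexp : exp (-lam * (c * (s + 1) * E ^ (-(1 / 2) : ℝ))) = r ^ (s + 1) := by
    rw [hr, ← exp_nat_mul, h12]
    congr 1
    push_cast
    field_simp
  rw [hexp, h32, abs_neg, abs_of_pos (by norm_num : (0 : ℝ) < 1 / 2)]
  ring

/-- Substitute `ℓ = c (s + 1) E^{-1/2}` level by level. All terms are nonnegative, and the bound of
order `(s + 1)⁻²` makes their integrals summable, which justifies both exchanges of sum and
integral, including at `μ = 0`. -/
lemma limDensity_eq_limCutoff {lam β μ : ℝ} (hlam : 0 < lam) (hβ : 0 < β) (hμ : μ ≤ 0) :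
    limDensity lam β μ = limCutoff lam β 0 μ (fun _ _ => 1) := by
  set φ : ℕ → ℝ → ℝ := fun s ℓ => lam ^ 2 * exp (-lam * ℓ) * occ β μ (energy ℓ (s + 1)) with hφ
  set ψ : ℕ → ℝ → ℝ := fun s E => π / √2 * (s + 1) * (|(-(1 / 2) : ℝ)| * E ^ (-(1 / 2) - 1 : ℝ) *
      (lam ^ 2 * exp (-lam * (π / √2 * (s + 1) * E ^ (-(1 / 2) : ℝ))) * occ β μ E)) with hψ
  have hφnn : ∀ s, ∀ ℓ ∈ Ioi (0 : ℝ), 0 ≤ φ s ℓ := fun s ℓ hℓ => by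
    have := occ_pos hβ (hμ.trans_lt (energy_pos hℓ s))
    simp only [hφ]; positivity
  have hψnn : ∀ s, ∀ E ∈ Ioi (0 : ℝ), 0 ≤ ψ s E := fun s E hE => by
    have := occ_pos hβ (hμ.trans_lt hE)
    have hE : (0 : ℝ) < E := hE
    simp only [hψ]; positivity
  have hφle : ∀ s, ∀ ℓ ∈ Ioi (0 : ℝ), φ s ℓ ≤
      lam ^ 2 * (1 / ((s : ℝ) + 1) ^ 2) * (exp (-lam * ℓ) * (2 / (β * π ^ 2) * ℓ ^ 2)) := by
    intro s ℓ hℓ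
    have h1 := indicator_occ_le_sq (ε := 0) hβ hμ hℓ s
    rw [indicator_of_mem (show energy ℓ (s + 1) ∈ Ioi 0 from energy_pos hℓ s)] at h1
    calc φ s ℓ ≤ lam ^ 2 * exp (-lam * ℓ) * (2 / (β * π ^ 2) * (1 / ((s : ℝ) + 1) ^ 2) * ℓ ^ 2) := by
          simp only [hφ]; gcongr
      _ = _ := by ring
  have hφm : ∀ s, Measurable (φ s) := fun s =>
    (by fun_prop : Measurable fun ℓ : ℝ => lam ^ 2 * exp (-lam * ℓ)).mul
      ((measurable_occ β μ).comp (measurable_energy (s + 1)))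
  have hdom := integrableOn_exp_mul_sq hlam (2 / (β * π ^ 2))
  have hφi : ∀ s, IntegrableOn (φ s) (Ioi 0) := fun s => by
    refine (hdom.const_mul (lam ^ 2 * (1 / ((s : ℝ) + 1) ^ 2))).mono'
      (hφm s).aestronglyMeasurable ?_
    filter_upwards [ae_restrict_mem measurableSet_Ioi] with ℓ hℓ
    rw [norm_of_nonneg (hφnn s ℓ hℓ)]
    exact hφle s ℓ hℓ
  have hφsum : Summable fun s => ∫ ℓ in Ioi (0 : ℝ), φ s ℓ := by
    refine Summable.of_nonneg_of_le (fun s => setIntegral_nonneg measurableSet_Ioi (hφnn s))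
      (fun s => setIntegral_mono_on (hφi s) (hdom.const_mul _) measurableSet_Ioi (hφle s)) ?_
    simp_rw [integral_const_mul]
    exact (summable_one_div_succ_sq.mul_left _).mul_right _
  have hcomp : ∀ s, ∀ E ∈ Ioi (0 : ℝ), ψ s E = π / √2 * (s + 1) *
      ((|(-(1 / 2) : ℝ)| * E ^ (-(1 / 2) - 1 : ℝ)) •
        φ s (π / √2 * (s + 1) * E ^ (-(1 / 2) : ℝ))) := fun s E hE => by
    simp only [hψ, hφ, smul_eq_mul, energy_mul_rpow s hE]
  have hCpos : ∀ s : ℕ, 0 < π / √2 * ((s : ℝ) + 1) := fun s => by positivity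
  have hint : ∀ s, ∫ E in Ioi (0 : ℝ), ψ s E = ∫ ℓ in Ioi (0 : ℝ), φ s ℓ := fun s => by
    rw [setIntegral_congr_fun measurableSet_Ioi (hcomp s), integral_const_mul,
      integral_comp_rpow_Ioi (fun y => φ s (π / √2 * (s + 1) * y)) (by norm_num)]
    have := integral_comp_mul_left_Ioi' (φ s) 0 (hCpos s)
    rwa [mul_zero, smul_eq_mul] at this
  have hψi : ∀ s, IntegrableOn (ψ s) (Ioi 0) := fun s => by
    rw [integrableOn_congr_fun (hcomp s) measurableSet_Ioi]
    refine Integrable.const_mul ?_ _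
    refine (integrableOn_Ioi_comp_rpow_iff (fun y => φ s (π / √2 * (s + 1) * y))
      (by norm_num : (-(1 / 2) : ℝ) ≠ 0)).2 ?_
    have := (integrableOn_Ioi_comp_mul_left_iff (φ s) 0 (hCpos s)).2
    rw [mul_zero] at this
    exact this (hφi s)
  have hnorm : ∀ {f : ℕ → ℝ → ℝ}, (∀ s, ∀ ℓ ∈ Ioi (0 : ℝ), 0 ≤ f s ℓ) →
      ∀ s, ∫ ℓ in Ioi (0 : ℝ), ‖f s ℓ‖ = ∫ ℓ in Ioi (0 : ℝ), f s ℓ := fun hf s =>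
    setIntegral_congr_fun measurableSet_Ioi fun ℓ hℓ => norm_of_nonneg (hf s ℓ hℓ)
  have h1 := hasSum_integral_of_summable_integral_norm hφi (by simpa only [hnorm hφnn] using hφsum)
  have h2 := hasSum_integral_of_summable_integral_norm hψi
    (by simpa only [hnorm hψnn, hint] using hφsum)
  simp only [hint] at h2
  have h3 := h2.unique h1
  have h4 : limDensity lam β μ = ∫ E in Ioi (0 : ℝ), ∑' s, ψ s E :=
    setIntegral_congr_fun measurableSet_Ioi fun E hE => (hasSum_dos lam β μ hlam hE).tsum_eq.symm
  rw [h4, h3, limCutoff, ← integral_const_mul]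
  refine setIntegral_congr_fun measurableSet_Ioi fun ℓ hℓ => ?_
  simp only [hφ, cutoffSum, mul_one]
  rw [tsum_mul_left, mul_assoc]
  congr 2
  refine tsum_congr fun s => ?_
  rw [indicator_of_mem (show energy ℓ (s + 1) ∈ Ioi 0 from energy_pos hℓ s)]

/-- In the variable `ℓ` the integrand is dominated by `e^{-λℓ} ℓ²` uniformly in `μ ≤ 0`. The
exponential rarity of long intervals is thus what makes the critical density finite. -/
lemma tendsto_limDensity {lam β : ℝ} (hlam : 0 < lam) (hβ : 0 < β) :
    Tendsto (limDensity lam β) (𝓝[<] 0) (𝓝 (limCutoff lam β 0 0 (fun _ _ => 1))) := by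
  have h : Tendsto (fun μ => limCutoff lam β 0 μ (fun _ _ => 1)) (𝓝[<] 0)
      (𝓝 (limCutoff lam β 0 0 (fun _ _ => 1))) := by
    refine tendsto_limCutoff hlam hβ (e := fun _ => 0) (w := fun _ _ _ => 1)
      (Eventually.of_forall fun _ => le_rfl) ?_ (fun _ _ => measurable_const) (by simp) ?_
    · filter_upwards [self_mem_nhdsWithin] with μ hμ using le_of_lt hμ
    · intro ℓ hℓ s
      have hE := energy_pos hℓ s
      simp only [indicator_of_mem (show energy ℓ (s + 1) ∈ Ioi 0 from hE), mul_one]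
      exact (continuousAt_occ_left hβ hE).tendsto.mono_left nhdsWithin_le_nhds
  refine h.congr' ?_
  filter_upwards [self_mem_nhdsWithin] with μ hμ
  exact (limDensity_eq_limCutoff hlam hβ (le_of_lt hμ)).symm

lemma critDensity_eq {lam β : ℝ} (hlam : 0 < lam) (hβ : 0 < β) :
    critDensity lam β = limCutoff lam β 0 0 (fun _ _ => 1) :=
  (tendsto_limDensity hlam hβ).limUnder_eq

/-- Removing the cutoff. -/
lemma tendsto_limCutoff_zero {lam β : ℝ} (hlam : 0 < lam) (hβ : 0 < β) {a : ℝ → ℕ → ℝ}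
    (ham : ∀ s, Measurable (fun ℓ => a ℓ s)) (ha : ∀ ℓ, 0 < ℓ → ∀ s, |a ℓ s| ≤ 1) :
    Tendsto (fun ε => limCutoff lam β ε 0 a) (𝓝[>] 0) (𝓝 (limCutoff lam β 0 0 a)) := by
  refine tendsto_limCutoff hlam hβ (m := fun _ => 0) (w := fun _ => a) ?_
    (Eventually.of_forall fun _ => le_rfl) (fun _ => ham) (fun _ => ha) ?_
  · filter_upwards [self_mem_nhdsWithin] with ε hε using le_of_lt hε
  · intro ℓ hℓ s
    have hE := energy_pos hℓ s
    refine tendsto_const_nhds.congr' ?_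
    filter_upwards [nhdsWithin_le_nhds (Iio_mem_nhds hE)] with ε hε
    rw [indicator_of_mem (show energy ℓ (s + 1) ∈ Ioi 0 from hE),
      indicator_of_mem (show energy ℓ (s + 1) ∈ Ioi ε from hε)]

/-- For each fixed `ℓ` the overlap is `0` as soon as `|d| > ℓ`; dominated convergence does the rest.
-/
lemma tendsto_limCutoff_overlap {lam β : ℝ} (hlam : 0 < lam) (hβ : 0 < β) :
    Tendsto (fun d : ℝ => limCutoff lam β 0 0 (overlap |d|))
      (comap (fun d : ℝ => |d|) atTop) (𝓝 0) := by
  have h0 : limCutoff lam β 0 0 (fun _ _ => 0) = 0 := by simp [limCutoff, cutoffSum]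
  have key : Tendsto (fun d : ℝ => limCutoff lam β 0 0 (overlap |d|))
      (comap (fun d : ℝ => |d|) atTop) (𝓝 (limCutoff lam β 0 0 (fun _ _ => 0))) := by
    refine tendsto_limCutoff (F := comap (fun d : ℝ => |d|) atTop) hlam hβ (e := fun _ => 0)
      (m := fun _ => 0) (w := fun d => overlap |d|) (Eventually.of_forall fun _ => le_rfl)
      (Eventually.of_forall fun _ => le_rfl) (fun d s => measurable_overlap |d| s)
      (fun d ℓ hℓ s => abs_overlap_le (abs_nonneg d) hℓ s) ?_
    intro ℓ hℓ s
    refine tendsto_const_nhds.congr' ?_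
    filter_upwards [tendsto_comap.eventually (eventually_gt_atTop ℓ)] with d hd
    rw [overlap, if_neg (not_le.2 hd)]
  rwa [h0] at key

lemma limCutoff_le_critDensity {lam β μ : ℝ} (hlam : 0 < lam) (hβ : 0 < β) (hμ : μ ≤ 0) :
    limCutoff lam β 0 μ (fun _ _ => 1) ≤ critDensity lam β := by
  rw [critDensity_eq hlam hβ]
  unfold limCutoff
  refine mul_le_mul_of_nonneg_left ?_ (sq_nonneg _)
  refine setIntegral_mono_on
    (integrableOn_exp_mul_cutoffSum hlam hβ le_rfl hμ (fun _ => measurable_const) (by simp))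
    (integrableOn_exp_mul_cutoffSum hlam hβ le_rfl le_rfl (fun _ => measurable_const) (by simp))
    measurableSet_Ioi fun ℓ hℓ => ?_
  refine mul_le_mul_of_nonneg_left ?_ (exp_pos _).le
  have hs : ∀ ν ≤ (0 : ℝ), Summable (fun s : ℕ => occ β ν (energy ℓ (s + 1))) := fun ν hν =>
    summable_occ hβ hℓ (hν.trans_lt (energy_pos hℓ 0))
  have e : ∀ ν, cutoffSum β 0 ν (fun _ _ => 1) ℓ = ∑' s : ℕ, occ β ν (energy ℓ (s + 1)) := fun ν =>
    tsum_congr fun s => by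
      rw [indicator_of_mem (show energy ℓ (s + 1) ∈ Ioi 0 from energy_pos hℓ s), mul_one]
  rw [e, e]
  exact (hs μ hμ).tsum_le_tsum (fun s => occ_mono hβ hμ (energy_pos hℓ s)) (hs 0 le_rfl)

lemma limCutoff_nonneg {lam β ε : ℝ} (hβ : 0 < β) (hε : 0 ≤ ε) :
    0 ≤ limCutoff lam β ε 0 (fun _ _ => 1) :=
  mul_nonneg (sq_nonneg _) (integral_nonneg fun _ => mul_nonneg (exp_pos _).le
    (tsum_nonneg fun _ => mul_nonneg (indicator_occ_nonneg hβ hε _) zero_le_one))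

/-! ### The finite-volume density and chemical potential -/

section FiniteVolume

variable {N : ℕ} {L β ε μ ρ ℓ : ℝ} {x : Fin N → ℝ}

lemma cutoffSum_zero_one {j : Fin (N + 1)} (hg : 0 < gap L x j) :
    cutoffSum β 0 μ (fun _ _ => 1) (gap L x j) =
      ∑' s : ℕ, occ β μ (energy (gap L x j) (s + 1)) :=
  tsum_congr fun s => by
    rw [indicator_of_mem (show energy (gap L x j) (s + 1) ∈ Ioi 0 from energy_pos hg s), mul_one]

lemma density_eq_cutoffSum (hg : ∀ j, 0 < gap L x j) :
    density L x β μ = 1 / L * ∑ j, cutoffSum β 0 μ (fun _ _ => 1) (gap L x j) := by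
  unfold density
  simp only [cutoffSum_zero_one (hg _)]

lemma density_lt_density (hL : 0 < L) (hβ : 0 < β) (hg : ∀ j, 0 < gap L x j) {ν : ℝ} (h : μ < ν)
    (hν : ∀ (j : Fin (N + 1)) (s : ℕ), ν < energy (gap L x j) (s + 1)) :
    density L x β μ < density L x β ν := by
  unfold density
  have hs : ∀ κ ≤ ν, ∀ j, Summable (fun s : ℕ => occ β κ (energy (gap L x j) (s + 1))) :=
    fun κ hκ j => summable_occ hβ (hg j) (hκ.trans_lt (hν j 0))
  refine mul_lt_mul_of_pos_left ?_ (by positivity)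
  refine Finset.sum_lt_sum_of_nonempty Finset.univ_nonempty fun j _ => ?_
  exact (hs μ h.le j).tsum_lt_tsum (i := 0) (fun s => (occ_lt_occ hβ h (hν j s)).le)
    (occ_lt_occ hβ h (hν j 0)) (hs ν le_rfl j)

lemma continuousAt_density (hβ : 0 < β) (hg : ∀ j, 0 < gap L x j)
    (hμ : ∀ j, μ < energy (gap L x j) 1) : ContinuousAt (density L x β) μ := by
  unfold density
  refine continuousAt_const.mul (tendsto_finsetSum _ fun j _ => ?_)
  obtain ⟨κ, hκ1, hκ2⟩ := exists_between (hμ j)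
  refine tendsto_tsum_of_dominated_convergence (summable_occ hβ (hg j) hκ2)
    (fun s => continuousAt_occ_left hβ ((hμ j).trans_le (energy_one_le _ s))) ?_
  filter_upwards [Iio_mem_nhds hκ1] with ν hν s
  have hE := hκ2.trans_le (energy_one_le (gap L x j) s)
  rw [norm_of_nonneg (occ_pos hβ ((show ν < κ from hν).trans hE)).le]
  exact occ_mono hβ (le_of_lt hν) hE

lemma abs_sum_cutoffSum_le (hL : 0 < L) (hβ : 0 < β) (hg : ∀ j, 0 < gap L x j) (h : μ < ε)
    {a : ℝ → ℕ → ℝ} (ha : ∀ ℓ, 0 < ℓ → ∀ s, |a ℓ s| ≤ 1) :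
    |1 / L * ∑ j, cutoffSum β ε μ a (gap L x j)| ≤ occConst β ε μ * (√(2 / (π * β)) / 2) := by
  rw [abs_mul, abs_of_pos (by positivity), one_div_mul_eq_div, div_le_iff₀ hL]
  refine (Finset.abs_sum_le_sum_abs _ _).trans ?_
  calc ∑ j, |cutoffSum β ε μ a (gap L x j)|
      ≤ ∑ j, occConst β ε μ * (√(2 / (π * β)) / 2) * gap L x j :=
        Finset.sum_le_sum fun j _ => abs_cutoffSum_le hβ h (hg j) (ha _ (hg j))
    _ = _ := by rw [← Finset.mul_sum, sum_gap]

lemma tendsto_occConst_atBot (hβ : 0 < β) : Tendsto (occConst β 0) atBot (𝓝 0) := by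
  unfold occConst
  have h : Tendsto (fun μ => exp (β * μ)) atBot (𝓝 0) :=
    tendsto_exp_atBot.comp (tendsto_id.const_mul_atBot hβ)
  have := h.div (h.const_sub 1) (by norm_num)
  rw [sub_zero, zero_div] at this
  refine this.congr fun μ => ?_
  simp

/-- The density is strictly increasing and continuous below the ground energy `m` of the longest
interval, small near `-∞` and large near `m`. -/
lemma existsUnique_chemPot (hL : 0 < L) (hβ : 0 < β) (hρ : 0 < ρ) (hg : ∀ j, 0 < gap L x j) :
    ∃! μ, IsChemPot L x β ρ μ := by
  obtain ⟨j₀, -, hj₀⟩ := Finset.exists_max_image Finset.univ (gap L x) Finset.univ_nonempty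
  set m := energy (gap L x j₀) 1 with hm
  have hmin : ∀ j, m ≤ energy (gap L x j) 1 := fun j =>
    energy_anti (hg j) (hj₀ j (Finset.mem_univ j)) 1
  have hmpos : 0 < m := energy_pos (hg j₀) 0
  have hbelow : ∀ μ < m, ∀ (j : Fin (N + 1)) (s : ℕ), μ < energy (gap L x j) (s + 1) :=
    fun μ hμ j s => hμ.trans_le ((hmin j).trans (energy_one_le _ s))
  have hlow : ∃ μ < (0 : ℝ), density L x β μ ≤ ρ := by
    have h1 : Tendsto (fun μ => occConst β 0 μ * (√(2 / (π * β)) / 2)) atBot (𝓝 0) := by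
      simpa using (tendsto_occConst_atBot hβ).mul_const (√(2 / (π * β)) / 2)
    obtain ⟨μ, hμ, hμ0⟩ := ((h1.eventually_lt_const hρ).and (eventually_lt_atBot 0)).exists
    refine ⟨μ, hμ0, ?_⟩
    rw [density_eq_cutoffSum hg]
    exact ((le_abs_self _).trans (abs_sum_cutoffSum_le hL hβ hg hμ0 (by simp))).trans hμ.le
  obtain ⟨μ₁, hμ₁0, hμ₁⟩ := hlow
  -- The logarithm makes the lowest level alone hold at least `ρ * L` particles; the minimum with
  -- `m` keeps `μ₂ ≥ 0`, hence to the right of `μ₁`.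
  set μ₂ := m - min (log (1 + 1 / (ρ * L)) / β) m with hμ₂
  have hlogpos : 0 < log (1 + 1 / (ρ * L)) / β :=
    div_pos (log_pos (by linarith [show 0 < 1 / (ρ * L) by positivity])) hβ
  have hμ₂m : μ₂ < m := by rw [hμ₂]; linarith [lt_min hlogpos hmpos]
  have hμ₂0 : 0 ≤ μ₂ := by rw [hμ₂]; linarith [min_le_right (log (1 + 1 / (ρ * L)) / β) m]
  have hhigh : ρ ≤ density L x β μ₂ := by
    have hocc : ρ * L ≤ occ β μ₂ m := by
      unfold occ
      have h1 : m - μ₂ ≤ log (1 + 1 / (ρ * L)) / β := by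
        rw [hμ₂]; linarith [min_le_left (log (1 + 1 / (ρ * L)) / β) m]
      have h2 : exp (β * (m - μ₂)) ≤ 1 + 1 / (ρ * L) := by
        rw [← le_log_iff_exp_le (by positivity)]
        rw [le_div_iff₀ hβ] at h1; linarith
      have h3 : 1 < exp (β * (m - μ₂)) := one_lt_exp_iff.2 (mul_pos hβ (by linarith))
      rw [le_div_iff₀ (by linarith)]
      calc ρ * L * (exp (β * (m - μ₂)) - 1) ≤ ρ * L * (1 / (ρ * L)) := by gcongr; linarith
        _ = 1 := by field_simp
    have h4 : occ β μ₂ m ≤ ∑' s : ℕ, occ β μ₂ (energy (gap L x j₀) (s + 1)) :=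
      (summable_occ hβ (hg j₀) hμ₂m).le_tsum 0 fun s _ => (occ_pos hβ (hbelow _ hμ₂m j₀ s)).le
    have h5 : ∑' s : ℕ, occ β μ₂ (energy (gap L x j₀) (s + 1)) ≤
        ∑ j, ∑' s : ℕ, occ β μ₂ (energy (gap L x j) (s + 1)) :=
      Finset.single_le_sum (f := fun j => ∑' s : ℕ, occ β μ₂ (energy (gap L x j) (s + 1)))
        (fun j _ => tsum_nonneg fun s => (occ_pos hβ (hbelow _ hμ₂m j s)).le) (Finset.mem_univ j₀)
    unfold density
    rw [one_div_mul_eq_div, le_div_iff₀ hL]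
    linarith
  obtain ⟨μ, hμ, hμρ⟩ := intermediate_value_Icc (hμ₁0.le.trans hμ₂0) (f := density L x β)
    (fun μ hμ => (continuousAt_density hβ hg fun j =>
      (hμ.2.trans_lt hμ₂m).trans_le (hmin j)).continuousWithinAt) ⟨hμ₁, hhigh⟩
  refine ⟨μ, ⟨hbelow μ (hμ.2.trans_lt hμ₂m), hμρ⟩, fun ν hν => ?_⟩
  by_contra hne
  rcases lt_or_gt_of_ne hne with h | h
  · have := density_lt_density hL hβ hg h (hbelow μ (hμ.2.trans_lt hμ₂m))
    rw [hν.2, hμρ] at this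
    exact lt_irrefl _ this
  · have := density_lt_density hL hβ hg h hν.1
    rw [hν.2, hμρ] at this
    exact lt_irrefl _ this

lemma isChemPot_chemPot (h : ∃ μ, IsChemPot L x β ρ μ) :
    IsChemPot L x β ρ (chemPot L x β ρ) := by
  unfold chemPot
  rw [dif_pos h]
  exact h.choose_spec

lemma summable_low (hβ : 0 < β) (hℓ : 0 < ℓ) (hμ : μ < energy ℓ 1) :
    Summable (fun s : ℕ => (Iic ε).indicator (occ β μ) (energy ℓ (s + 1))) := by
  refine Summable.of_nonneg_of_le (fun s => indicator_apply_nonneg fun _ => ?_) (fun s => ?_)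
    (summable_occ hβ hℓ hμ)
  · exact (occ_pos hβ (hμ.trans_le (energy_one_le ℓ s))).le
  · exact indicator_apply_le' (fun _ => le_rfl) fun _ =>
      (occ_pos hβ (hμ.trans_le (energy_one_le ℓ s))).le

lemma indicator_Iic_add_Ioi (f : ℝ → ℝ) (E : ℝ) :
    (Iic ε).indicator f E + (Ioi ε).indicator f E = f E := by
  rw [← compl_Iic]
  exact congrFun (indicator_self_add_compl (Iic ε) f) E

lemma density_eq_low_add (hβ : 0 < β) (hg : ∀ j, 0 < gap L x j) (hε : μ < ε)
    (hμ : ∀ (j : Fin (N + 1)) (s : ℕ), μ < energy (gap L x j) (s + 1)) :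
    density L x β μ = lowDensity L x β μ ε +
      1 / L * ∑ j, cutoffSum β ε μ (fun _ _ => 1) (gap L x j) := by
  unfold density lowDensity cutoffSum
  rw [← mul_add, ← Finset.sum_add_distrib]
  congr 1
  refine Finset.sum_congr rfl fun j _ => ?_
  simp only [mul_one]
  rw [← (summable_low hβ (hg j) (hμ j 0)).tsum_add (summable_indicator_occ hβ hε (hg j))]
  exact tsum_congr fun s => (indicator_Iic_add_Ioi _ _).symm

end FiniteVolume

/-! ### The space-averaged density matrix in finite volume -/

section Eigenfun

variable {a b : ℝ}

lemma measurable_eigenfun (a b : ℝ) (s : ℕ) : Measurable (eigenfun a b s) := by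
  unfold eigenfun
  exact Measurable.indicator (by fun_prop) measurableSet_Ioo

lemma abs_eigenfun_le (a b : ℝ) (s : ℕ) (w : ℝ) :
    |eigenfun a b s w| ≤ (Ioo a b).indicator (fun _ => √(2 / (b - a))) w := by
  unfold eigenfun
  by_cases hw : w ∈ Ioo a b
  · rw [indicator_of_mem hw, indicator_of_mem hw, abs_mul, abs_of_nonneg (sqrt_nonneg _)]
    exact mul_le_of_le_one_right (sqrt_nonneg _) (abs_sin_le_one _)
  · rw [indicator_of_notMem hw, indicator_of_notMem hw, abs_zero]

lemma abs_eigenfun_mul_le (hab : a < b) (s : ℕ) (w w' : ℝ) :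
    |eigenfun a b s w * eigenfun a b s w'| ≤ (Ioo a b).indicator (fun _ => 2 / (b - a)) w := by
  have h0 : (0 : ℝ) ≤ 2 / (b - a) := div_nonneg zero_le_two (sub_nonneg.2 hab.le)
  have h1 := abs_eigenfun_le a b s w
  have h2 : |eigenfun a b s w'| ≤ √(2 / (b - a)) :=
    (abs_eigenfun_le a b s w').trans (indicator_apply_le' (fun _ => le_rfl) fun _ => sqrt_nonneg _)
  rw [abs_mul]
  by_cases hw : w ∈ Ioo a b
  · rw [indicator_of_mem hw] at h1 ⊢
    calc _ ≤ √(2 / (b - a)) * √(2 / (b - a)) := by gcongr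
      _ = _ := mul_self_sqrt h0
  · rw [indicator_of_notMem hw] at h1 ⊢
    rw [le_antisymm h1 (abs_nonneg _), zero_mul]

lemma abs_eigenfun_mul_le_const (hab : a < b) (s : ℕ) (w w' : ℝ) :
    |eigenfun a b s w * eigenfun a b s w'| ≤ 2 / (b - a) :=
  (abs_eigenfun_mul_le hab s w w').trans
    (indicator_apply_le' (fun _ => le_rfl) fun _ => div_nonneg zero_le_two (sub_nonneg.2 hab.le))

lemma integrable_eigenfun_mul (hab : a < b) (s : ℕ) (u v : ℝ) :
    Integrable (fun z => eigenfun a b s (u + z) * eigenfun a b s (v + z)) := by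
  have hdom : Integrable (fun z => (Ioo a b).indicator (fun _ => 2 / (b - a)) (u + z)) := by
    refine Integrable.comp_add_left (f := (Ioo a b).indicator (fun _ => 2 / (b - a))) ?_ u
    exact (integrable_indicator_iff measurableSet_Ioo).2 (by simp)
  refine hdom.mono' ?_ (Eventually.of_forall fun z => abs_eigenfun_mul_le hab s _ _)
  exact (((measurable_eigenfun a b s).comp (measurable_const_add u)).mul
    ((measurable_eigenfun a b s).comp (measurable_const_add v))).aestronglyMeasurable

/-- Product-to-sum formulas give an explicit antiderivative. The hypothesis `hkl` is the only trace
of the quantization of `k * ℓ` that the boundary terms need. -/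
lemma integral_sin_mul_sin {k ℓ d : ℝ} (hk : k ≠ 0) (hℓ : ℓ ≠ 0) (hkl : sin (2 * (k * ℓ) - k * d) = -sin (k * d)) :
    ∫ w in a..(a + (ℓ - d)), 2 / ℓ * (sin (k * (w - a)) * sin (k * (w + d - a))) =
      (1 - d / ℓ) * cos (k * d) + sin (k * d) / (k * ℓ) := by
  have hderiv : ∀ w ∈ uIcc a (a + (ℓ - d)), HasDerivAt
      (fun w => 1 / ℓ * (w * cos (k * d) - sin (2 * k * (w - a) + k * d) / (2 * k)))
      (2 / ℓ * (sin (k * (w - a)) * sin (k * (w + d - a)))) w := by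
    intro w _
    have h1 : HasDerivAt (fun w => 2 * k * (w - a) + k * d) (2 * k) w := by
      simpa using (((hasDerivAt_id w).sub_const a).const_mul (2 * k)).add_const (k * d)
    have h2 : HasDerivAt (fun w => w * cos (k * d)) (cos (k * d)) w := by
      simpa using (hasDerivAt_id w).mul_const (cos (k * d))
    refine ((h2.sub (h1.sin.div_const (2 * k))).const_mul (1 / ℓ)).congr_deriv ?_
    have e1 : cos (k * d) = cos (k * (w + d - a) - k * (w - a)) := by ring_nf
    have e2 : cos (2 * k * (w - a) + k * d) = cos (k * (w + d - a) + k * (w - a)) := by ring_nf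
    rw [e1, e2, cos_sub, cos_add]
    field_simp
    ring
  rw [intervalIntegral.integral_eq_sub_of_hasDerivAt hderiv
    (Continuous.intervalIntegrable (by fun_prop) _ _)]
  have e3 : 2 * k * (a + (ℓ - d) - a) + k * d = 2 * (k * ℓ) - k * d := by ring
  rw [e3, hkl, sub_self, mul_zero, zero_add]
  field_simp
  ring

/-- The two factors are both nonzero only for `z` in `(a, b - d)`, which is empty when `d > b - a`;
this is the origin of the case distinction in `overlap`. -/
lemma integral_eigenfun_mul_of_nonneg (hab : a < b) (s : ℕ) {d : ℝ} (hd : 0 ≤ d) :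
    ∫ z, eigenfun a b (s + 1) z * eigenfun a b (s + 1) (z + d) = overlap d (b - a) s := by
  have hℓ : 0 < b - a := sub_pos.2 hab
  set k := π * (s + 1) / (b - a) with hk
  have hkpos : 0 < k := by positivity
  have hprod : (fun z => eigenfun a b (s + 1) z * eigenfun a b (s + 1) (z + d)) =
      (Ioo a (b - d)).indicator (fun z => 2 / (b - a) * (sin (k * (z - a)) * sin (k * (z + d - a)))) := by
    funext z
    unfold eigenfun
    push_cast
    rw [← hk]
    by_cases h1 : z ∈ Ioo a b
    · by_cases h2 : z + d ∈ Ioo a b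
      · rw [indicator_of_mem h1, indicator_of_mem h2,
          indicator_of_mem (show z ∈ Ioo a (b - d) from ⟨h1.1, by linarith [h2.2]⟩)]
        calc _ = √(2 / (b - a)) * √(2 / (b - a)) * (sin (k * (z - a)) * sin (k * (z + d - a))) := by
              ring
          _ = _ := by rw [mul_self_sqrt (by positivity)]
      · rw [indicator_of_notMem h2, mul_zero, indicator_of_notMem]
        exact fun h3 => h2 ⟨by linarith [h3.1], by linarith [h3.2]⟩
    · rw [indicator_of_notMem h1, zero_mul, indicator_of_notMem]
      exact fun h3 => h1 ⟨h3.1, by linarith [h3.2]⟩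
  rw [hprod, integral_indicator measurableSet_Ioo]
  by_cases hdl : d ≤ b - a
  · rw [← integral_Ioc_eq_integral_Ioo, ← intervalIntegral.integral_of_le (by linarith),
      show b - d = a + ((b - a) - d) by ring, integral_sin_mul_sin hkpos.ne' hℓ.ne', overlap,
      if_pos hdl]
    · have : k * (b - a) = π * (s + 1) := by rw [hk]; field_simp
      rw [this]
    · have : 2 * (k * (b - a)) = ((s + 1 : ℕ) : ℝ) * (2 * π) := by rw [hk]; push_cast; field_simp
      rw [this, sin_nat_mul_two_pi_sub]
  · rw [overlap, if_neg hdl, Ioo_eq_empty (by push Not at hdl ⊢; linarith)]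
    simp

lemma integral_eigenfun_mul (hab : a < b) (s : ℕ) (u v : ℝ) :
    ∫ z, eigenfun a b (s + 1) (u + z) * eigenfun a b (s + 1) (v + z) =
      overlap |u - v| (b - a) s := by
  wlog huv : u ≤ v generalizing u v
  · rw [abs_sub_comm, ← this v u (le_of_not_ge huv)]
    simp only [mul_comm]
  rw [abs_sub_comm, abs_of_nonneg (sub_nonneg.2 huv),
    ← integral_eigenfun_mul_of_nonneg hab s (sub_nonneg.2 huv)]
  have := integral_add_left_eq_self (μ := volume)
    (fun z => eigenfun a b (s + 1) z * eigenfun a b (s + 1) (z + (v - u))) u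
  rw [← this]
  congr 1
  funext z
  ring_nf

/-- Cutting the translation parameter off at the boundary of the volume costs little. -/
lemma abs_integral_eigenfun_sub_le (hab : a < b) (s : ℕ) (u v L : ℝ) (hL : 0 < L) :
    |(∫ z in (-L / 2)..(L / 2), eigenfun a b (s + 1) (u + z) * eigenfun a b (s + 1) (v + z)) -
      overlap |u - v| (b - a) s| ≤
      2 / (b - a) * volume.real ({z | u + z ∈ Ioo a b} \ Ioc (-L / 2) (L / 2)) := by
  have hint := integrable_eigenfun_mul hab (s + 1) u v
  rw [intervalIntegral.integral_of_le (by linarith), ← integral_eigenfun_mul hab s u v,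
    ← integral_add_compl measurableSet_Ioc hint, sub_add_cancel_left, abs_neg]
  have hm : MeasurableSet {z | u + z ∈ Ioo a b} :=
    (measurable_const_add u) measurableSet_Ioo
  have hfin : volume {z | u + z ∈ Ioo a b} < ⊤ := by
    have : volume {z | u + z ∈ Ioo a b} = volume (Ioo a b) := measure_preimage_add volume u (Ioo a b)
    rw [this]; exact measure_Ioo_lt_top
  have hle : ∀ z, ‖eigenfun a b (s + 1) (u + z) * eigenfun a b (s + 1) (v + z)‖ ≤
      {z | u + z ∈ Ioo a b}.indicator (fun _ => 2 / (b - a)) z := fun z =>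
    abs_eigenfun_mul_le hab (s + 1) _ _
  rw [← Real.norm_eq_abs]
  refine (norm_integral_le_integral_norm _).trans ?_
  have hi : IntegrableOn ({z | u + z ∈ Ioo a b}.indicator fun _ => 2 / (b - a))
      (Ioc (-L / 2) (L / 2))ᶜ :=
    ((integrable_indicator_iff hm).2 (integrableOn_const hfin.ne)).integrableOn
  refine (setIntegral_mono hint.norm.integrableOn hi hle).trans_eq ?_
  rw [setIntegral_indicator hm, setIntegral_const, smul_eq_mul, inter_comm, ← sdiff_eq]
  ring

end Eigenfun

/-! ### Boundary losses and the splitting into low and high levels -/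

section Matrix

variable {N : ℕ} {L β ε μ : ℝ} {x : Fin N → ℝ}

/-- The part of the `j`-th interval which is lost when averaging over translations by `[-L/2, L/2]`. -/
def lostLength (L : ℝ) (x : Fin N → ℝ) (u : ℝ) (j : Fin (N + 1)) : ℝ :=
  volume.real ({z | u + z ∈ Ioo (left L x j) (right L x j)} \ Ioc (-L / 2) (L / 2))

lemma lostLength_nonneg (u : ℝ) (j : Fin (N + 1)) : 0 ≤ lostLength L x u j := measureReal_nonneg

/-- The lost pieces are disjoint and all lie beyond the same end of the box, in one interval of
length `|u|`; so the total loss does not grow with the number of intervals. -/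
lemma sum_lostLength_le (hg : ∀ j, 0 < gap L x j) (u : ℝ) :
    ∑ j, lostLength L x u j ≤ |u| := by
  have hm : ∀ j : Fin (N + 1), MeasurableSet
      ({z | u + z ∈ Ioo (left L x j) (right L x j)} \ Ioc (-L / 2) (L / 2)) := fun j =>
    ((measurable_const_add u) measurableSet_Ioo).diff measurableSet_Ioc
  have hdisj : Pairwise (Function.onFun Disjoint fun j : Fin (N + 1) =>
      ({z | u + z ∈ Ioo (left L x j) (right L x j)} \ Ioc (-L / 2) (L / 2))) := by
    have : ∀ j k : Fin (N + 1), j < k → Disjoint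
        ({z | u + z ∈ Ioo (left L x j) (right L x j)} \ Ioc (-L / 2) (L / 2))
        ({z | u + z ∈ Ioo (left L x k) (right L x k)} \ Ioc (-L / 2) (L / 2)) := fun j k hjk => by
      rw [Set.disjoint_left]
      rintro z ⟨h1, _⟩ ⟨h2, _⟩
      exact absurd (h1.2.trans_le (right_le_left hg hjk)) (not_lt.2 h2.1.le)
    intro j k hjk
    rcases lt_or_gt_of_ne hjk with h | h
    · exact this j k h
    · exact (this k j h).symm
  have hfin : ∀ j : Fin (N + 1),
      volume ({z | u + z ∈ Ioo (left L x j) (right L x j)} \ Ioc (-L / 2) (L / 2)) ≠ ⊤ := fun j => by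
    refine ((measure_mono (t := Icc (left L x j - u) (right L x j - u)) ?_).trans_lt
      measure_Icc_lt_top).ne
    rintro z ⟨h1, _⟩
    have h2 : left L x j < u + z := h1.1
    have h3 : u + z < right L x j := h1.2
    exact ⟨by linarith, by linarith⟩
  unfold lostLength
  rw [← measureReal_iUnion_fintype hdisj hm hfin]
  rcases le_or_gt 0 u with hu | hu
  · have hsub' : (⋃ j : Fin (N + 1), {z | u + z ∈ Ioo (left L x j) (right L x j)} \
        Ioc (-L / 2) (L / 2)) ⊆ Icc (-L / 2 - u) (-L / 2) := by
      refine iUnion_subset fun j => ?_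
      rintro z ⟨h1, h2⟩
      have h3 := neg_half_le_left hg j
      have h4 := right_le_half hg j
      have h5 : left L x j < u + z := h1.1
      have h6 : u + z < right L x j := h1.2
      refine ⟨by linarith, ?_⟩
      by_contra h7
      exact h2 ⟨not_le.1 h7, by linarith⟩
    refine (measureReal_mono hsub' measure_Icc_lt_top.ne).trans_eq ?_
    rw [Real.volume_real_Icc_of_le (by linarith), abs_of_nonneg hu]
    ring
  · have hsub' : (⋃ j : Fin (N + 1), {z | u + z ∈ Ioo (left L x j) (right L x j)} \
        Ioc (-L / 2) (L / 2)) ⊆ Icc (L / 2) (L / 2 - u) := by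
      refine iUnion_subset fun j => ?_
      rintro z ⟨h1, h2⟩
      have h3 := neg_half_le_left hg j
      have h4 := right_le_half hg j
      have h5 : left L x j < u + z := h1.1
      have h6 : u + z < right L x j := h1.2
      refine ⟨?_, by linarith⟩
      by_contra h7
      exact h2 ⟨by linarith, (not_le.1 h7).le⟩
    refine (measureReal_mono hsub' measure_Icc_lt_top.ne).trans_eq ?_
    rw [Real.volume_real_Icc_of_le (by linarith), abs_of_neg hu]
    ring

/-- The overlap of an eigenfunction with its translate, averaged over `[-L/2, L/2]`. -/
def boxOverlap (L : ℝ) (x : Fin N → ℝ) (u v : ℝ) (j : Fin (N + 1)) (s : ℕ) : ℝ :=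
  ∫ z in (-L / 2)..(L / 2), eigenfun (left L x j) (right L x j) (s + 1) (u + z) *
    eigenfun (left L x j) (right L x j) (s + 1) (v + z)

/-- Sum and integral may be exchanged because a product of eigenfunctions is at most `2 / gap` and
the occupation numbers of each interval are summable. -/
lemma avgDensityMatrix_eq (hL : 0 < L) (hβ : 0 < β) (hg : ∀ j, 0 < gap L x j)
    (hμ : ∀ (j : Fin (N + 1)) (s : ℕ), μ < energy (gap L x j) (s + 1)) (u v : ℝ) :
    avgDensityMatrix L x β μ u v = 1 / L * ∑ j, ∑' s : ℕ,
      occ β μ (energy (gap L x j) (s + 1)) * boxOverlap L x u v j s := by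
  have hle : -L / 2 ≤ L / 2 := by linarith
  unfold avgDensityMatrix densityMatrix boxOverlap
  rw [intervalIntegral.integral_of_le hle]
  congr 1
  set T : Fin (N + 1) → ℕ → ℝ → ℝ := fun j s z => occ β μ (energy (gap L x j) (s + 1)) *
    (eigenfun (left L x j) (right L x j) (s + 1) (u + z) *
      eigenfun (left L x j) (right L x j) (s + 1) (v + z)) with hT
  have hTm : ∀ j s, Measurable (T j s) := fun j s =>
    (((measurable_eigenfun _ _ (s + 1)).comp (measurable_const_add u)).mul
      ((measurable_eigenfun _ _ (s + 1)).comp (measurable_const_add v))).const_mul _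
  have hTle : ∀ j s z, ‖T j s z‖ ≤ occ β μ (energy (gap L x j) (s + 1)) * (2 / gap L x j) := by
    intro j s z
    have hpos := occ_pos hβ (hμ j s)
    rw [hT, norm_mul, norm_of_nonneg hpos.le]
    exact mul_le_mul_of_nonneg_left (abs_eigenfun_mul_le_const (left_lt_right hg j) _ _ _) hpos.le
  have hocc : ∀ j, Summable fun s : ℕ => occ β μ (energy (gap L x j) (s + 1)) * (2 / gap L x j) :=
    fun j => (summable_occ hβ (hg j) (hμ j 0)).mul_right _
  have hfin : volume (Ioc (-L / 2) (L / 2)) ≠ ⊤ := measure_Ioc_lt_top.ne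
  have hTi : ∀ j s, IntegrableOn (T j s) (Ioc (-L / 2) (L / 2)) := fun j s =>
    ((integrable_eigenfun_mul (left_lt_right hg j) (s + 1) u v).const_mul _).integrableOn
  rw [integral_finsetSum]
  · refine Finset.sum_congr rfl fun j _ => ?_
    have hsum : Summable fun s => ∫ z in Ioc (-L / 2) (L / 2), ‖T j s z‖ := by
      refine Summable.of_nonneg_of_le (fun s => integral_nonneg fun z => norm_nonneg _)
        (fun s => ?_) ((hocc j).mul_right (volume.real (Ioc (-L / 2) (L / 2))))
      have := setIntegral_mono (hTi j s).norm (integrableOn_const hfin) (hTle j s)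
      rw [setIntegral_const, smul_eq_mul, mul_comm] at this
      exact this
    rw [← (hasSum_integral_of_summable_integral_norm (hTi j) hsum).tsum_eq]
    refine tsum_congr fun s => ?_
    simp only [hT]
    rw [integral_const_mul, intervalIntegral.integral_of_le hle]
  · intro j _
    have hm : Measurable fun z => ∑' s, T j s z := Measurable.tsum (hTm j)
    refine Measure.integrableOn_of_bounded (M := ∑' s : ℕ, occ β μ (energy (gap L x j) (s + 1)) *
      (2 / gap L x j)) hfin hm.aestronglyMeasurable (Eventually.of_forall fun z => ?_)
    exact tsum_of_norm_bounded (hocc j).hasSum fun s => hTle j s z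

/-- The averaged density matrix is close to its high-energy part plus the low-energy density. -/
lemma abs_avgDensityMatrix_sub_le (hL : 0 < L) (hβ : 0 < β) (hg : ∀ j, 0 < gap L x j) (hε : μ < ε)
    (hμ : ∀ (j : Fin (N + 1)) (s : ℕ), μ < energy (gap L x j) (s + 1)) (u v : ℝ) :
    |avgDensityMatrix L x β μ u v -
      (1 / L * ∑ j, cutoffSum β ε μ (overlap |u - v|) (gap L x j) + lowDensity L x β μ ε)| ≤
      lowDensity L x β μ ε * (|u - v| ^ 2 * ε + 2 * |u - v| * √ε + 2 * |u| * √ε) +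
        2 * (occConst β ε μ * (√(2 / (π * β)) / 2)) * |u| / L := by
  set d := |u - v| with hd
  have hd0 : 0 ≤ d := abs_nonneg _
  set η := d ^ 2 * ε + 2 * d * √ε + 2 * |u| * √ε with hη
  set K := occConst β ε μ * (√(2 / (π * β)) / 2) with hK
  have hKnn : 0 ≤ K := mul_nonneg (occConst_pos hβ hε).le (by positivity)
  have hlost : ∀ j, lostLength L x u j ≤ |u| := fun j =>
    (Finset.single_le_sum (fun k _ => lostLength_nonneg u k) (Finset.mem_univ j)).trans
      (sum_lostLength_le hg u)
  have hbox : ∀ j s, |boxOverlap L x u v j s - overlap d (gap L x j) s| ≤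
      2 / gap L x j * lostLength L x u j := fun j s =>
    abs_integral_eigenfun_sub_le (left_lt_right hg j) s u v L hL
  have hover : ∀ j s, |overlap d (gap L x j) s| ≤ 1 := fun j s => abs_overlap_le hd0 (hg j) s
  set O : Fin (N + 1) → ℕ → ℝ := fun j s => occ β μ (energy (gap L x j) (s + 1)) with hO
  set lo : Fin (N + 1) → ℕ → ℝ := fun j s =>
    (Iic ε).indicator (occ β μ) (energy (gap L x j) (s + 1)) with hlo
  set hi : Fin (N + 1) → ℕ → ℝ := fun j s =>
    (Ioi ε).indicator (occ β μ) (energy (gap L x j) (s + 1)) with hhi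
  have hOsplit : ∀ j s, O j s = lo j s + hi j s := fun j s =>
    (indicator_Iic_add_Ioi (ε := ε) (occ β μ) _).symm
  have hlonn : ∀ j s, 0 ≤ lo j s := fun j s =>
    indicator_apply_nonneg fun _ => (occ_pos hβ (hμ j s)).le
  have hhinn : ∀ j s, 0 ≤ hi j s := fun j s => indicator_occ_nonneg hβ hε.le _
  have hloS : ∀ j, Summable (lo j) := fun j => summable_low hβ (hg j) (hμ j 0)
  have hhiS : ∀ j, Summable (hi j) := fun j => summable_indicator_occ hβ hε (hg j)
  have hhisum : ∀ j, ∑' s, hi j s ≤ K * gap L x j := fun j => by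
    have h := abs_cutoffSum_le (a := fun _ _ => 1) hβ hε (hg j) (by simp)
    unfold cutoffSum at h
    simp only [mul_one] at h
    exact (le_abs_self _).trans h
  have hcutS : ∀ j, Summable fun s => hi j s * overlap d (gap L x j) s := fun j =>
    summable_cutoff hβ hε (hg j) (hover j)
  have hboxS : ∀ j, Summable fun s => O j s * boxOverlap L x u v j s := fun j => by
    refine Summable.of_norm_bounded (g := fun s => O j s * (2 / gap L x j * lostLength L x u j + 1))
      ((summable_occ hβ (hg j) (hμ j 0)).mul_right _) fun s => ?_
    have hpos : 0 < O j s := occ_pos hβ (hμ j s)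
    rw [norm_mul, norm_of_nonneg hpos.le]
    refine mul_le_mul_of_nonneg_left ?_ hpos.le
    have h1 := hbox j s
    have h2 := hover j s
    have h3 := abs_sub_abs_le_abs_sub (boxOverlap L x u v j s) (overlap d (gap L x j) s)
    rw [Real.norm_eq_abs]
    linarith
  have hterm : ∀ j, |∑' s, O j s * boxOverlap L x u v j s -
      (∑' s, hi j s * overlap d (gap L x j) s + ∑' s, lo j s)| ≤
      (∑' s, lo j s) * η + 2 * K * lostLength L x u j := by
    intro j
    have hgj := hg j
    rw [← (hcutS j).tsum_add (hloS j), ← (hboxS j).tsum_sub ((hcutS j).add (hloS j))]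
    -- Low levels are compared with weight `1`, high levels with their own overlap. The boundary
    -- loss of a low level is at most `2 * |u| * √ε`, because its interval is long.
    have hbnd : ∀ s, ‖O j s * boxOverlap L x u v j s - (hi j s * overlap d (gap L x j) s + lo j s)‖ ≤
        lo j s * η + hi j s * (2 / gap L x j * lostLength L x u j) := by
      intro s
      have e : O j s * boxOverlap L x u v j s - (hi j s * overlap d (gap L x j) s + lo j s) =
          lo j s * (boxOverlap L x u v j s - 1) +
            hi j s * (boxOverlap L x u v j s - overlap d (gap L x j) s) := by
        rw [hOsplit]; ring
      rw [e]
      refine (norm_add_le _ _).trans (add_le_add ?_ ?_)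
      · rw [norm_mul, norm_of_nonneg (hlonn j s)]
        by_cases hE : energy (gap L x j) (s + 1) ≤ ε
        · refine mul_le_mul_of_nonneg_left ?_ (hlonn j s)
          have h1 := abs_overlap_sub_one_le hd0 hgj s hE
          have h2 := hbox j s
          have h3 := inv_le_sqrt_of_energy_le hgj s hE
          have h4 : 2 / gap L x j * lostLength L x u j ≤ 2 * |u| * √ε := by
            calc 2 / gap L x j * lostLength L x u j = 2 * (1 / gap L x j) * lostLength L x u j := by
                  ring
              _ ≤ 2 * √ε * |u| := by
                  have := hlost j
                  gcongr
                  exact lostLength_nonneg u j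
              _ = _ := by ring
          have h5 := abs_sub_le (boxOverlap L x u v j s) (overlap d (gap L x j) s) 1
          rw [Real.norm_eq_abs]
          linarith
        · have : lo j s = 0 := indicator_of_notMem (show energy (gap L x j) (s + 1) ∉ Iic ε from hE) _
          rw [this, zero_mul, zero_mul]
      · rw [norm_mul, norm_of_nonneg (hhinn j s)]
        exact mul_le_mul_of_nonneg_left (hbox j s) (hhinn j s)
    refine (tsum_of_norm_bounded (((hloS j).mul_right η).add ((hhiS j).mul_right _)).hasSum
      hbnd).trans ?_
    rw [((hloS j).mul_right η).tsum_add ((hhiS j).mul_right _), tsum_mul_right, tsum_mul_right]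
    refine add_le_add le_rfl ?_
    -- The linear bound on the high-level sum cancels the normalization `2 / gap`, so only the lost
    -- length remains; its sum over `j` is bounded and vanishes after division by `L`.
    calc (∑' s, hi j s) * (2 / gap L x j * lostLength L x u j)
        ≤ K * gap L x j * (2 / gap L x j * lostLength L x u j) := by
          gcongr
          · exact mul_nonneg (by positivity) (lostLength_nonneg u j)
          · exact hhisum j
      _ = 2 * K * lostLength L x u j := by field_simp
  rw [avgDensityMatrix_eq hL hβ hg hμ]
  have elow : lowDensity L x β μ ε = 1 / L * ∑ j, ∑' s, lo j s := rfl
  have ecut : (∑ j, cutoffSum β ε μ (overlap d) (gap L x j)) =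
      ∑ j, ∑' s, hi j s * overlap d (gap L x j) s := rfl
  rw [elow, ecut, ← mul_add, ← Finset.sum_add_distrib, ← mul_sub, ← Finset.sum_sub_distrib, abs_mul,
    abs_of_pos (by positivity : 0 < 1 / L)]
  calc _ ≤ 1 / L * ∑ j, ((∑' s, lo j s) * η + 2 * K * lostLength L x u j) := by
        gcongr
        exact (Finset.abs_sum_le_sum_abs _ _).trans (Finset.sum_le_sum fun j _ => hterm j)
    _ = 1 / L * (∑ j, ∑' s, lo j s) * η + 2 * K * (∑ j, lostLength L x u j) / L := by
        rw [Finset.sum_add_distrib, ← Finset.sum_mul, ← Finset.mul_sum]; ring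
    _ ≤ _ := by
        have := sum_lostLength_le hg u
        gcongr

end Matrix

/-! ### The thermodynamic limit for a typical sequence of configurations -/

/-- The properties of a sequence of impurity configurations which hold almost surely and imply
all the limits: the gaps are positive, and the densities of empty windows converge. -/
structure IsTypical (lam : ℝ) (L : ℕ → ℝ) (x : (N : ℕ) → Fin N → ℝ) : Prop where
  gap_pos : ∀ N j, 0 < gap (L N) (x N) j
  tendsto_window : ∀ t : ℚ, 0 < t →
    Tendsto (fun N => 1 / L N * ∑ j, max (gap (L N) (x N) j - t) 0) atTop (𝓝 (exp (-(lam * t))))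

section Typical

variable {lam β ρ : ℝ} {L : ℕ → ℝ} {x : (N : ℕ) → Fin N → ℝ}

lemma IsTypical.tendsto_cutoff (hx : IsTypical lam L x) (hlam : 0 < lam) (hβ : 0 < β)
    (hL : ∀ N, 0 < L N) {ε μ : ℝ} (h : μ < ε) {a : ℝ → ℕ → ℝ}
    (ham : ∀ s, Measurable (fun ℓ => a ℓ s)) (ha : ∀ ℓ, 0 < ℓ → ∀ s, |a ℓ s| ≤ 1)
    (hac : ∀ᵐ ℓ ∂(volume.restrict (Ioi (0 : ℝ))), ∀ s, ContinuousAt (fun m => a m s) ℓ) :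
    Tendsto (fun N => 1 / L N * ∑ j, cutoffSum β ε μ a (gap (L N) (x N) j)) atTop
      (𝓝 (limCutoff lam β ε μ a)) := by
  refine tendsto_sum_gaps hlam hL hx.gap_pos (fun N => sum_gap) hx.tendsto_window
    (measurable_cutoffSum ham) (fun ℓ hℓ => abs_cutoffSum_le hβ h hℓ (ha ℓ hℓ)) ?_
  filter_upwards [hac, ae_energy_ne ε, ae_restrict_mem measurableSet_Ioi] with ℓ h1 h2 h3
  exact continuousAt_cutoffSum hβ h h3 ha h1 h2

lemma tendsto_occConst {β ε : ℝ} (hβ : 0 < β) (hε : 0 < ε) {m : ℕ → ℝ}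
    (hm : Tendsto m atTop (𝓝 0)) :
    Tendsto (fun N => occConst β ε (m N)) atTop (𝓝 (occConst β ε 0)) := by
  have : ContinuousAt (fun μ => occConst β ε μ) 0 := by
    unfold occConst
    have h1 : exp (-(β * (ε - 0))) < 1 := exp_lt_one_iff.2 (by nlinarith [mul_pos hβ hε])
    exact ContinuousAt.div (by fun_prop) (by fun_prop) (by linarith)
  exact this.tendsto.comp hm

/-- The chemical potential depends on the configuration, so the law of large numbers is used only at
`μ = 0`; the difference is at most a vanishing constant times `gap`, and the gaps sum to `L`. -/
lemma IsTypical.tendsto_cutoff_of_tendsto (hx : IsTypical lam L x) (hlam : 0 < lam) (hβ : 0 < β)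
    (hL : ∀ N, 0 < L N) {ε : ℝ} (hε : 0 < ε) {m : ℕ → ℝ} (hm : Tendsto m atTop (𝓝 0))
    {a : ℝ → ℕ → ℝ}
    (ham : ∀ s, Measurable (fun ℓ => a ℓ s)) (ha : ∀ ℓ, 0 < ℓ → ∀ s, |a ℓ s| ≤ 1)
    (hac : ∀ᵐ ℓ ∂(volume.restrict (Ioi (0 : ℝ))), ∀ s, ContinuousAt (fun m => a m s) ℓ) :
    Tendsto (fun N => 1 / L N * ∑ j, cutoffSum β ε (m N) a (gap (L N) (x N) j)) atTop
      (𝓝 (limCutoff lam β ε 0 a)) := by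
  have h0 := hx.tendsto_cutoff hlam hβ hL hε ham ha hac
  set K := √(2 / (π * β)) / 2
  have hbound : ∀ᶠ N in atTop, ‖1 / L N * ∑ j, cutoffSum β ε (m N) a (gap (L N) (x N) j) -
      1 / L N * ∑ j, cutoffSum β ε 0 a (gap (L N) (x N) j)‖ ≤
      occConst β ε (m N) * occConst β ε 0 * |1 - exp (-(β * m N))| * K := by
    filter_upwards [hm.eventually_lt_const hε] with N hN
    have hLN := hL N
    rw [← mul_sub, ← Finset.sum_sub_distrib, norm_mul, norm_of_nonneg (by positivity),
      one_div_mul_eq_div, div_le_iff₀ hLN]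
    refine (norm_sum_le _ _).trans ?_
    calc _ ≤ ∑ j, occConst β ε (m N) * occConst β ε 0 * |1 - exp (-(β * m N))| * K *
          gap (L N) (x N) j := Finset.sum_le_sum fun j _ =>
            abs_cutoffSum_sub_le hβ hN hε (hx.gap_pos N j) (ha _ (hx.gap_pos N j))
      _ = _ := by rw [← Finset.mul_sum, sum_gap]
  have hlim : Tendsto (fun N => occConst β ε (m N) * occConst β ε 0 * |1 - exp (-(β * m N))| * K)
      atTop (𝓝 0) := by
    have h1 : Tendsto (fun N => |1 - exp (-(β * m N))|) atTop (𝓝 0) := by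
      have hc : ContinuousAt (fun y => |1 - exp (-(β * y))|) 0 := by fun_prop
      have := hc.tendsto.comp hm
      simpa [Function.comp_def] using this
    have := (((tendsto_occConst hβ hε hm).mul_const (occConst β ε 0)).mul h1).mul_const K
    simpa using this
  have := (squeeze_zero_norm' hbound hlim).add h0
  rw [zero_add] at this
  exact this.congr fun N => sub_add_cancel _ _

lemma critDensity_nonneg (hlam : 0 < lam) (hβ : 0 < β) : 0 ≤ critDensity lam β := by
  rw [critDensity_eq hlam hβ]
  exact limCutoff_nonneg hβ le_rfl

lemma IsTypical.existsUnique_chemPot (hx : IsTypical lam L x) (hlam : 0 < lam) (hβ : 0 < β)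
    (hL : ∀ N, 0 < L N) (hρ : critDensity lam β < ρ) (N : ℕ) :
    ∃! μ, IsChemPot (L N) (x N) β ρ μ :=
  LuttingerSy.existsUnique_chemPot (hL N) hβ ((critDensity_nonneg hlam hβ).trans_lt hρ) (hx.gap_pos N)

lemma IsTypical.isChemPot (hx : IsTypical lam L x) (hlam : 0 < lam) (hβ : 0 < β)
    (hL : ∀ N, 0 < L N) (hρ : critDensity lam β < ρ) (N : ℕ) :
    IsChemPot (L N) (x N) β ρ (chemPot (L N) (x N) β ρ) :=
  isChemPot_chemPot (hx.existsUnique_chemPot hlam hβ hL hρ N).exists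

/-- From below: for `δ < 0` the limiting density at `δ` is at most `ρ_c < ρ`, so monotonicity puts
the solution above `δ`. From above: windows of every length persist in the limit, hence a gap long
enough to have ground energy below `δ` exists. -/
lemma IsTypical.tendsto_chemPot (hx : IsTypical lam L x) (hlam : 0 < lam) (hβ : 0 < β)
    (hL : ∀ N, 0 < L N) (hρ : critDensity lam β < ρ) :
    Tendsto (fun N => chemPot (L N) (x N) β ρ) atTop (𝓝 0) := by
  have hcp := hx.isChemPot hlam hβ hL hρ
  rw [tendsto_order]
  constructor
  · intro δ hδ
    have h1 := hx.tendsto_cutoff hlam hβ hL hδ (a := fun _ _ => 1) (fun _ => measurable_const)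
      (by simp) (Eventually.of_forall fun _ _ => continuousAt_const)
    have h2 := (limCutoff_le_critDensity hlam hβ hδ.le).trans_lt hρ
    filter_upwards [h1.eventually_lt_const h2] with N hN
    rw [← density_eq_cutoffSum (hx.gap_pos N)] at hN
    by_contra! hle
    rcases hle.eq_or_lt with h | h
    · rw [← h, (hcp N).2] at hN; exact lt_irrefl _ hN
    · have := density_lt_density (hL N) hβ (hx.gap_pos N) h
        (fun j s => hδ.trans (energy_pos (hx.gap_pos N j) s))
      rw [(hcp N).2] at this
      exact lt_asymm this hN
  · intro δ hδ
    -- The ground energy at length `t` is `π² / (2t²)`; requiring `t > 1` gives `t² > t`, so `t > π²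
    -- / (2δ)` suffices.
    obtain ⟨t, ht⟩ := exists_rat_gt (max 1 (π ^ 2 / (2 * δ)))
    have ht1 : (1 : ℝ) < t := (le_max_left _ _).trans_lt ht
    have ht2 : π ^ 2 / (2 * δ) < t := (le_max_right _ _).trans_lt ht
    have hE : energy t 1 < δ := by
      unfold energy
      rw [div_lt_iff₀ (by positivity)] at ht2
      push_cast
      rw [one_pow, mul_one, ← mul_div_assoc, div_lt_iff₀ (by positivity)]
      nlinarith
    have ht0 : 0 < t := by exact_mod_cast one_pos.trans ht1
    filter_upwards [(hx.tendsto_window t ht0).eventually_const_lt (exp_pos _)] with N hN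
    have hex : ∃ j, (t : ℝ) < gap (L N) (x N) j := by
      by_contra! hall
      have : ∑ j, max (gap (L N) (x N) j - t) 0 = 0 :=
        Finset.sum_eq_zero fun j _ => max_eq_right (by linarith [hall j])
      rw [this, mul_zero] at hN
      exact lt_irrefl _ hN
    obtain ⟨j, hj⟩ := hex
    exact ((hcp N).1 j 0).trans_le ((energy_anti (by linarith) hj.le 1).trans hE.le)

/-- The density of the particles below `ε` in the thermodynamic limit. -/
def limLow (lam β ρ ε : ℝ) : ℝ := ρ - limCutoff lam β ε 0 (fun _ _ => 1)

/-- The low density is not covered by the law of large numbers; it is obtained as the complement, in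
the fixed total `ρ`, of the high-level density. -/
lemma IsTypical.tendsto_lowDensity (hx : IsTypical lam L x) (hlam : 0 < lam) (hβ : 0 < β)
    (hL : ∀ N, 0 < L N) (hρ : critDensity lam β < ρ) {ε : ℝ} (hε : 0 < ε) :
    Tendsto (fun N => lowDensity (L N) (x N) β (chemPot (L N) (x N) β ρ) ε) atTop
      (𝓝 (limLow lam β ρ ε)) := by
  have hcp := hx.isChemPot hlam hβ hL hρ
  have hm := hx.tendsto_chemPot hlam hβ hL hρ
  have h1 := hx.tendsto_cutoff_of_tendsto hlam hβ hL hε hm (a := fun _ _ => 1)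
    (fun _ => measurable_const) (by simp) (Eventually.of_forall fun _ _ => continuousAt_const)
  refine (h1.const_sub ρ).congr' ?_
  filter_upwards [hm.eventually_lt_const hε] with N hN
  have := density_eq_low_add hβ (hx.gap_pos N) hN (hcp N).1
  rw [(hcp N).2] at this
  linarith

lemma tendsto_limLow (hlam : 0 < lam) (hβ : 0 < β) (ρ : ℝ) :
    Tendsto (limLow lam β ρ) (𝓝[>] 0) (𝓝 (ρ - critDensity lam β)) := by
  rw [critDensity_eq hlam hβ]
  exact (tendsto_limCutoff_zero hlam hβ (fun _ => measurable_const) (by simp)).const_sub ρ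

lemma limLow_le (hβ : 0 < β) {ε : ℝ} (hε : 0 ≤ ε) : limLow lam β ρ ε ≤ ρ := by
  unfold limLow
  linarith [limCutoff_nonneg (lam := lam) hβ hε]

lemma IsTypical.tendsto_avgDensityMatrix (hx : IsTypical lam L x) (hlam : 0 < lam) (hβ : 0 < β)
    (hL : ∀ N, 0 < L N) (hLtop : Tendsto L atTop atTop) (hρ : critDensity lam β < ρ) (u v : ℝ) :
    Tendsto (fun N => avgDensityMatrix (L N) (x N) β (chemPot (L N) (x N) β ρ) u v) atTop
      (𝓝 (limCutoff lam β 0 0 (overlap |u - v|) + (ρ - critDensity lam β))) := by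
  have hcp := hx.isChemPot hlam hβ hL hρ
  have hm := hx.tendsto_chemPot hlam hβ hL hρ
  set d := |u - v| with hd
  have hd0 : 0 ≤ d := abs_nonneg _
  have ham := measurable_overlap d
  have ha : ∀ ℓ, 0 < ℓ → ∀ s, |overlap d ℓ s| ≤ 1 := fun ℓ hℓ s => abs_overlap_le hd0 hℓ s
  have hac : ∀ᵐ ℓ ∂(volume.restrict (Ioi (0 : ℝ))), ∀ s, ContinuousAt (fun m => overlap d m s) ℓ := by
    have hne : ∀ᵐ ℓ ∂(volume : Measure ℝ), ℓ ≠ d := by simp [ae_iff]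
    filter_upwards [ae_restrict_of_ae hne, ae_restrict_mem measurableSet_Ioi] with ℓ h1 h2 s
    exact continuousAt_overlap h2 h1 s
  set err : ℝ → ℝ := fun ε => d ^ 2 * ε + 2 * d * √ε + 2 * |u| * √ε with herr
  have hD : Tendsto (fun ε => limCutoff lam β ε 0 (overlap d) + limLow lam β ρ ε) (𝓝[>] 0)
      (𝓝 (limCutoff lam β 0 0 (overlap d) + (ρ - critDensity lam β))) :=
    (tendsto_limCutoff_zero hlam hβ ham ha).add (tendsto_limLow hlam hβ ρ)
  have hE : Tendsto (fun ε => ρ * err ε) (𝓝[>] 0) (𝓝 0) := by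
    have hc : ContinuousAt (fun ε => ρ * err ε) 0 := by
      simp only [herr]; fun_prop
    have := hc.tendsto.mono_left (nhdsWithin_le_nhds (s := Ioi 0))
    simpa [herr] using this
  rw [Metric.tendsto_nhds]
  intro η hη
  -- The cutoff is chosen before `N`: `h1` removes it from the limit at cost `η / 3`, and `h2` makes
  -- the low-level overlap error small uniformly, since the low density has a limit at most `ρ`. The
  -- third `η / 3` is spent on `N → ∞`.
  obtain ⟨ε, ⟨h1, h2⟩, hε⟩ := (((Metric.tendsto_nhds.1 hD (η / 3) (by positivity)).and
    (hE.eventually_lt_const (by positivity : 0 < η / 3))).and self_mem_nhdsWithin).exists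
  have hε : 0 < ε := hε
  set A : ℕ → ℝ := fun N => 1 / L N * ∑ j, cutoffSum β ε (chemPot (L N) (x N) β ρ) (overlap d)
    (gap (L N) (x N) j) + lowDensity (L N) (x N) β (chemPot (L N) (x N) β ρ) ε with hA
  set B : ℕ → ℝ := fun N => lowDensity (L N) (x N) β (chemPot (L N) (x N) β ρ) ε * err ε +
    2 * (occConst β ε (chemPot (L N) (x N) β ρ) * (√(2 / (π * β)) / 2)) * |u| / L N with hB
  have hlow := hx.tendsto_lowDensity hlam hβ hL hρ hε
  have hAlim : Tendsto A atTop (𝓝 (limCutoff lam β ε 0 (overlap d) + limLow lam β ρ ε)) :=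
    (hx.tendsto_cutoff_of_tendsto hlam hβ hL hε hm ham ha hac).add hlow
  have hBlim : Tendsto B atTop (𝓝 (limLow lam β ρ ε * err ε)) := by
    have h3 := ((((tendsto_occConst hβ hε hm).mul_const (√(2 / (π * β)) / 2)).const_mul 2).mul_const
      |u|).div_atTop hLtop
    have := (hlow.mul_const (err ε)).add h3
    rwa [add_zero] at this
  have herr0 : 0 ≤ err ε := by simp only [herr]; positivity
  have hB2 : limLow lam β ρ ε * err ε < η / 3 :=
    (mul_le_mul_of_nonneg_right (limLow_le hβ hε.le) herr0).trans_lt h2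
  filter_upwards [Metric.tendsto_nhds.1 hAlim (η / 3) (by positivity),
    hBlim.eventually_lt_const hB2, hm.eventually_lt_const hε] with N hN1 hN2 hN3
  have hmain := abs_avgDensityMatrix_sub_le (hL N) hβ (hx.gap_pos N) hN3 (hcp N).1 u v
  change |avgDensityMatrix (L N) (x N) β (chemPot (L N) (x N) β ρ) u v - A N| ≤ B N at hmain
  rw [Real.dist_eq] at h1 hN1 ⊢
  have e1 := abs_sub_le (avgDensityMatrix (L N) (x N) β (chemPot (L N) (x N) β ρ) u v) (A N)
    (limCutoff lam β 0 0 (overlap d) + (ρ - critDensity lam β))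
  have e2 := abs_sub_le (A N) (limCutoff lam β ε 0 (overlap d) + limLow lam β ρ ε)
    (limCutoff lam β 0 0 (overlap d) + (ρ - critDensity lam β))
  linarith

end Typical

/-- Impurity configurations are almost surely typical. -/
lemma ae_isTypical {Ω : Type*} [MeasurableSpace Ω] {P : Measure Ω}
    [IsProbabilityMeasure P] {lam : ℝ} {L : ℕ → ℝ} {X : (N : ℕ) → Fin N → Ω → ℝ} (hlam : 0 < lam)
    (hL : ∀ N, 0 < L N)
    (hLlam : Tendsto (fun N : ℕ => ((N : ℝ) + 1) / L N) atTop (𝓝 lam))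
    (hXmeas : ∀ N i, Measurable (X N i))
    (hXunif : ∀ N i, pdf.IsUniform (X N i) (Icc (-L N / 2) (L N / 2)) P volume)
    (hXindep : ∀ N, iIndepFun (X N) P) :
    ∀ᵐ ω ∂P, IsTypical lam L (fun N i => X N i ω) := by
  have hwin : ∀ᵐ ω ∂P, ∀ t : ℚ, 0 < t → Tendsto
      (fun N => 1 / L N * volume.real (emptyWindows (L N) t (fun i => X N i ω))) atTop
      (𝓝 (exp (-(lam * t)))) := by
    refine ae_all_iff.2 fun t => ?_
    by_cases ht : 0 < t
    · filter_upwards [ae_tendsto_emptyWindows hlam hL hLlam hXmeas hXunif hXindep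
        (show (0 : ℝ) < t by exact_mod_cast ht)] with ω hω _
      exact hω
    · exact Eventually.of_forall fun ω h => absurd h ht
  filter_upwards [ae_gap_pos hL hXmeas hXunif hXindep, hwin] with ω h1 h2
  refine ⟨h1, fun t ht => (h2 t ht).congr fun N => ?_⟩
  rw [volume_emptyWindows (by exact_mod_cast ht) (h1 N)]

end LuttingerSy

end

theorem mainTheorem4
    {Ω : Type*} [MeasurableSpace Ω] (P : Measure Ω) [IsProbabilityMeasure P]
    (lam β ρ : ℝ) (hlam : 0 < lam) (hβ : 0 < β)
    -- the volumes: `N` impurities, hence `N + 1` intervals, in `[-L N / 2, L N / 2]`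
    (L : ℕ → ℝ) (hL : ∀ N, 0 < L N)
    (hLlam : Tendsto (fun N : ℕ => ((N : ℝ) + 1) / L N) atTop (𝓝 lam))
    -- for each `N`, the impurity positions are independent and uniform in the volume
    (X : (N : ℕ) → Fin N → Ω → ℝ)
    (hXmeas : ∀ N i, Measurable (X N i))
    (hXunif : ∀ N i, pdf.IsUniform (X N i) (Icc (-L N / 2) (L N / 2)) P volume)
    (hXindep : ∀ N, iIndepFun (X N) P)
    (hρ : LuttingerSy.critDensity lam β < ρ) :
    -- the critical density is a genuine (finite) limit
    Tendsto (LuttingerSy.limDensity lam β) (𝓝[<] 0) (𝓝 (LuttingerSy.critDensity lam β)) ∧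
    -- the finite-volume chemical potential is well defined, and converges to `0`
    (∀ᵐ ω ∂P, ∀ N,
      ∃! μ : ℝ, LuttingerSy.IsChemPot (L N) (fun i => X N i ω) β ρ μ) ∧
    (∀ᵐ ω ∂P,
      Tendsto (fun N => LuttingerSy.chemPot (L N) (fun i => X N i ω) β ρ) atTop (𝓝 0)) ∧
    ∃ (ρ₀ : ℝ) (low : ℝ → ℝ) (ρlim : ℝ → ℝ → ℝ),
      -- `ρ₀` is the condensate density
      (∀ ε : ℝ, 0 < ε → ∀ᵐ ω ∂P,
        Tendsto (fun N => LuttingerSy.lowDensity (L N) (fun i => X N i ω) β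
          (LuttingerSy.chemPot (L N) (fun i => X N i ω) β ρ) ε) atTop (𝓝 (low ε))) ∧
      Tendsto low (𝓝[>] 0) (𝓝 ρ₀) ∧
      ρ₀ = ρ - LuttingerSy.critDensity lam β ∧
      0 < ρ₀ ∧
      -- `ρlim` is the almost sure, nonrandom limit of the space-averaged density matrix
      (∀ x y : ℝ, ∀ᵐ ω ∂P,
        Tendsto (fun N => LuttingerSy.avgDensityMatrix (L N) (fun i => X N i ω) β
          (LuttingerSy.chemPot (L N) (fun i => X N i ω) β ρ) x y) atTop (𝓝 (ρlim x y))) ∧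
      -- off-diagonal long-range order
      Tendsto (fun p : ℝ × ℝ => ρlim p.1 p.2)
        (comap (fun p : ℝ × ℝ => |p.1 - p.2|) atTop) (𝓝 ρ₀) := by
  have htyp := LuttingerSy.ae_isTypical hlam hL hLlam hXmeas hXunif hXindep
  have hLtop := (LuttingerSy.tendsto_volume_atTop hlam hL hLlam).2
  refine ⟨?_, ?_, ?_, ρ - LuttingerSy.critDensity lam β, LuttingerSy.limLow lam β ρ,
    fun u v => LuttingerSy.limCutoff lam β 0 0 (LuttingerSy.overlap |u - v|) +
      (ρ - LuttingerSy.critDensity lam β), ?_, LuttingerSy.tendsto_limLow hlam hβ ρ, rfl,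
    sub_pos.2 hρ, ?_, ?_⟩
  · rw [LuttingerSy.critDensity_eq hlam hβ]
    exact LuttingerSy.tendsto_limDensity hlam hβ
  · filter_upwards [htyp] with ω hω N
    exact hω.existsUnique_chemPot hlam hβ hL hρ N
  · filter_upwards [htyp] with ω hω
    exact hω.tendsto_chemPot hlam hβ hL hρ
  · intro ε hε
    filter_upwards [htyp] with ω hω
    exact hω.tendsto_lowDensity hlam hβ hL hρ hε
  · intro u v
    filter_upwards [htyp] with ω hω
    exact hω.tendsto_avgDensityMatrix hlam hβ hL hLtop hρ u v
  · have h : Tendsto (fun p : ℝ × ℝ => p.1 - p.2)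
        (comap (fun p : ℝ × ℝ => |p.1 - p.2|) atTop) (comap (fun d : ℝ => |d|) atTop) :=
      tendsto_comap_iff.2 tendsto_comap
    simpa using ((LuttingerSy.tendsto_limCutoff_overlap hlam hβ).comp h).add_const
      (ρ - LuttingerSy.critDensity lam β)
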